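/- Let $\mathbb{M}$ be a finite set of modalities and $\mathbb{T}$ a set of tokens whose elements are effectively coded. Formulas are given by $A,B ::= \top \mid \bot \mid t \mid \mathcal{M}A \mid A\Rightarrow B \mid A\wedge B \mid A\vee B$ with $t\in\mathbb{T}$, $\mathcal{M}\in\mathbb{M}$. An unfolding axiom is a pair $\mathcal{M}\Rrightarrow l$ with $\mathcal{M}\in\mathbb{M}$ and $l\in\mathbb{M}^*$ (possibly empty); it stands for $\mathcal{M}X\Rightarrow l(X)$. For a set $\mathsf{Ax}$ of unfolding axioms, $\mathcal{L}_{\mathsf{Ax}}$ is intuitionistic multimodal logic with the usual natural-deduction rules for the propositional connectives on sequents $\Gamma\vdash A$ and the two rules $$\frac{\Gamma\vdash\mathcal{M}A_1\ \cdots\ \Gamma\vdash\mathcal{M}A_n\quad A_1,\dots,A_n\vdash B}{\Gamma\vdash\mathcal{M}B}\ (n\ge 0),\qquad \frac{\Gamma\vdash\mathcal{M}A\quad \mathcal{M}\Rrightarrow l\in\mathsf{Ax}}{\Gamma\vdash l(A)} .$$ $\mathsf{Ax}$ is reflexive if $\mathcal{M}\Rrightarrow\mathcal{M}\in\mathsf{Ax}$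 for all $\mathcal{M}$; transitive if $\mathcal{M}\Rrightarrow l\cdot\mathcal{N}\cdot l'\in\mathsf{Ax}$ and $\mathcal{N}\Rrightarrow r\in\mathsf{Ax}$ imply $\mathcal{M}\Rrightarrow l\cdot r\cdot l'\in\mathsf{Ax}$; decomposable if for every $\mathcal{M}\Rrightarrow\mathcal{N}\cdot\mathcal{N}'\cdot l\in\mathsf{Ax}$ there is $\mathcal{R}\in\mathbb{M}$ such that $\mathcal{M}\Rrightarrow\mathcal{N}\cdot\mathcal{R}\in\mathsf{Ax}$ and, for all $\mathcal{T}$ and $r$, $\mathcal{M}\Rrightarrow\mathcal{N}\cdot\mathcal{T}\cdot r\in\mathsf{Ax}$ implies $\mathcal{R}\Rrightarrow\mathcal{T}\cdot r\in\mathsf{Ax}$. A choice of such $\mathcal{R}$ is denoted $\mathcal{M}\ominus\mathcal{N}$, a partial operation, defined exactly when such an axiom $\mathcal{M}\Rrightarrow\mathcal{N}\cdot\mathcal{N}'\cdot l$ exists. For a finite list $\Gamma$ of formulas (a flat context), $\Gamma\ominus\mathcal{N}$ consists, for each $\mathcal{M}B$ in $\Gamma$, of $B$ if $\mathcal{M}\Rrightarrow\mathcal{N}\in\mathsf{Ax}$,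 and of $(\mathcal{M}\ominus\mathcal{N})B$ if $\mathcal{M}\ominus\mathcal{N}$ is defined. **(1)** Let $\mathsf{Ax}$ be reflexive, transitive and decomposable. Then each of the following is decidable (a computable predicate of the coded input): (a) given a finite list $\Gamma$ of formulas and a formula $A$, whether $\Gamma\vdash A$ is derivable in $\mathcal{L}_{\mathsf{Ax}}$; (b) for every choice of $\ominus$, given a flat context $\Gamma$ and a formula $A$, whether $\Gamma\vdash A$ is provable in the cut-free sequent calculus whose rules are: $\Gamma\vdash t$ if the token $t$ is in $\Gamma$; the right rule for $\top$ and the left rule for $\bot$; the usual left rules (keeping the principal formula, which may stand anywhere in the context) and right rules for $\Rightarrow,\wedge,\vee$; and from $\Gamma\ominus\mathcal{M}\vdash A$ infer $\Gamma\vdash\mathcal{M}A$; (c) given a modal context $\Gamma ::= \varepsilon\mid\Gamma,x:A\mid\Gamma,\{\mathcal{M}\}$ and a formula $A$, whether there is a term $P$ with $\Gamma\vdash P:A$ in the Fitch-style lambda calculus whose typing rules are the usual ones for $\top,\bot,\Rightarrow,\wedge,\vee$ together with: $\Gamma,x:A,\Delta\vdash\mathtt{var}(x):A$ if $\Delta$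 contains no modality; from $\Gamma,\{\mathcal{M}\}\vdash P:A$ infer $\Gamma\vdash\mathtt{lock}_{\mathcal{M}}(P):\mathcal{M}A$; and from $\Gamma\vdash P:\mathcal{M}A$ and $\mathcal{M}\Rrightarrow l\in\mathsf{Ax}$ infer $\Gamma,\Delta\vdash\mathtt{key}_{\mathcal{M}\Rrightarrow l}(P):A$ whenever the list of modalities of $\Delta$ is $l$. **(2)** Let $\mathbb{A}$ be a finite set of agents with a preorder $\sqsubseteq$, let the modalities be $\mathcal{B}_a$, $\mathcal{I}_{a\leftarrow b}$ ($a,b\in\mathbb{A}$) and $\Box$, and let $\mathsf{Ax}$ consist of $\mathcal{B}_a\Rrightarrow\mathcal{B}_a\mathcal{B}_a$; $\mathcal{I}_{a\leftarrow b}\Rrightarrow\mathcal{B}_a\mathcal{I}_{a\leftarrow b}$; $\mathcal{I}_{a\leftarrow b}\Rrightarrow\mathcal{I}_{a\leftarrow b}\mathcal{B}_b$; $\mathcal{B}_a\Rrightarrow\mathcal{B}_b$, $\mathcal{I}_{a\leftarrow c}\Rrightarrow\mathcal{I}_{b\leftarrow c}$ and $\mathcal{I}_{c\leftarrow a}\Rrightarrow\mathcal{I}_{c\leftarrow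 b}$ for $a\sqsubseteq b$; $\Box\Rrightarrow\mathcal{M}\Box$ for every modality $\mathcal{M}$; and $\Box\Rrightarrow\varepsilon$. Then the least reflexive and transitive set of unfolding axioms containing $\mathsf{Ax}$ is decomposable, and derivability of sequents with finitely many assumptions in $\mathcal{L}_{\mathsf{Ax}}$ is decidable. -/

import Mathlib

namespace ModalLogic

universe u v

/-- Formulas over a set `𝕄` of modalities and a set `𝕋` of tokens. -/
inductive Formula (𝕄 : Type u) (𝕋 : Type v) : Type (max u v)
  | top : Formula 𝕄 𝕋
  | bot : Formula 𝕄 𝕋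
  | tok : 𝕋 → Formula 𝕄 𝕋
  | box : 𝕄 → Formula 𝕄 𝕋 → Formula 𝕄 𝕋
  | imp : Formula 𝕄 𝕋 → Formula 𝕄 𝕋 → Formula 𝕄 𝕋
  | and : Formula 𝕄 𝕋 → Formula 𝕄 𝕋 → Formula 𝕄 𝕋
  | or : Formula 𝕄 𝕋 → Formula 𝕄 𝕋 → Formula 𝕄 𝕋

namespace Formula

variable {𝕄 : Type u} {𝕋 : Type v}

/-- `l(A)`: the formula `A` prefixed by the modalities of the list `l`. -/
def boxes (l : List 𝕄) (A : Formula 𝕄 𝕋) : Formula 𝕄 𝕋 := l.foldr box A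

section Coding

/-! The Gödel numbering of formulas, which makes `Formula 𝕄 𝕋` a `Primcodable` type. -/

variable [Primcodable 𝕄] [Primcodable 𝕋]

/-- The code of a formula: one plus the pair of a tag and the codes of the components. -/
def code : Formula 𝕄 𝕋 → ℕ
  | top => Nat.pair 0 0 + 1
  | bot => Nat.pair 1 0 + 1
  | tok t => Nat.pair 2 (Encodable.encode t) + 1
  | box m A => Nat.pair 3 (Nat.pair (Encodable.encode m) A.code) + 1
  | imp A B => Nat.pair 4 (Nat.pair A.code B.code) + 1
  | and A B => Nat.pair 5 (Nat.pair A.code B.code) + 1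
  | or A B => Nat.pair 6 (Nat.pair A.code B.code) + 1

theorem unpair_left_lt (n : ℕ) : n.unpair.2.unpair.1 < n + 1 :=
  Nat.lt_succ_of_le ((Nat.unpair_left_le _).trans (Nat.unpair_right_le _))

theorem unpair_right_lt (n : ℕ) : n.unpair.2.unpair.2 < n + 1 :=
  Nat.lt_succ_of_le ((Nat.unpair_right_le _).trans (Nat.unpair_right_le _))

/-- The inverse of `code`. -/
def decodeNat : ℕ → Option (Formula 𝕄 𝕋)
  | 0 => none
  | n + 1 =>
    have h1 := unpair_left_lt n
    have h2 := unpair_right_lt n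
    let p := n.unpair.2
    if n.unpair.1 = 0 then some top
    else if n.unpair.1 = 1 then some bot
    else if n.unpair.1 = 2 then (Encodable.decode (α := 𝕋) p).map tok
    else if n.unpair.1 = 3 then
      (Encodable.decode (α := 𝕄) p.unpair.1).bind fun m => (decodeNat p.unpair.2).map (box m)
    else
      (decodeNat p.unpair.1).bind fun A => (decodeNat p.unpair.2).map fun B =>
        if n.unpair.1 = 4 then imp A B else if n.unpair.1 = 5 then and A B else or A B

theorem decodeNat_code (A : Formula 𝕄 𝕋) : decodeNat A.code = some A := by
  induction A <;> simp_all [code, decodeNat]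

instance instEncodable : Encodable (Formula 𝕄 𝕋) := ⟨code, decodeNat, decodeNat_code⟩

/-- One step of the course-of-values recursion that computes `encode (decodeNat n)` from the list
of the values below `n`. -/
def codeStep (𝕄 : Type u) (𝕋 : Type v) [Primcodable 𝕄] [Primcodable 𝕋] (L : List ℕ) : ℕ :=
  let n := L.length - 1
  let p := n.unpair.2
  let x := L.getD p.unpair.1 0
  let y := L.getD p.unpair.2 0
  let t := Encodable.encode (Encodable.decode (α := 𝕋) p)
  let m := Encodable.encode (Encodable.decode (α := 𝕄) p.unpair.1)
  if L.length = 0 then 0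
  else if n.unpair.1 = 0 then Nat.pair 0 0 + 2
  else if n.unpair.1 = 1 then Nat.pair 1 0 + 2
  else if n.unpair.1 = 2 then (if t = 0 then 0 else Nat.pair 2 (t - 1) + 2)
  else if n.unpair.1 = 3 then
    (if m = 0 then 0 else if y = 0 then 0 else Nat.pair 3 (Nat.pair (m - 1) (y - 1)) + 2)
  else if x = 0 then 0 else if y = 0 then 0
  else if n.unpair.1 = 4 then Nat.pair 4 (Nat.pair (x - 1) (y - 1)) + 2
  else if n.unpair.1 = 5 then Nat.pair 5 (Nat.pair (x - 1) (y - 1)) + 2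
  else Nat.pair 6 (Nat.pair (x - 1) (y - 1)) + 2

theorem codeStep_eq (n : ℕ) :
    codeStep 𝕄 𝕋 ((List.range n).map fun k =>
      Encodable.encode (decodeNat k : Option (Formula 𝕄 𝕋))) =
      Encodable.encode (decodeNat n : Option (Formula 𝕄 𝕋)) := by
  cases n with
  | zero => simp [codeStep, decodeNat]
  | succ n =>
    have h1 := unpair_left_lt n
    have h2 := unpair_right_lt n
    have e : ∀ A : Formula 𝕄 𝕋, Encodable.encode A = A.code := fun _ => rfl
    rw [decodeNat]
    simp only [codeStep, List.length_map, List.length_range, Nat.add_sub_cancel,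
      List.getD_eq_getElem?_getD, List.getElem?_map, List.getElem?_range h1,
      List.getElem?_range h2, Option.map_some, Option.getD_some]
    generalize (decodeNat n.unpair.2.unpair.1 : Option (Formula 𝕄 𝕋)) = a
    generalize (decodeNat n.unpair.2.unpair.2 : Option (Formula 𝕄 𝕋)) = b
    generalize (Encodable.decode n.unpair.2 : Option 𝕋) = t
    generalize (Encodable.decode n.unpair.2.unpair.1 : Option 𝕄) = m
    rcases a with _ | a <;> rcases b with _ | b <;> rcases t with _ | t <;>
      rcases m with _ | m <;> simp <;> split_ifs <;> simp [e, code]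

theorem primrec_codeStep : Primrec (codeStep 𝕄 𝕋) := by
  have hlen : Primrec fun L : List ℕ => L.length := Primrec.list_length
  have hn : Primrec fun L : List ℕ => L.length - 1 := Primrec.pred.comp hlen
  have hu := Primrec.unpair.comp hn
  have htag := Primrec.fst.comp hu
  have hp := Primrec.snd.comp hu
  have hpu := Primrec.unpair.comp hp
  have hx := (Primrec.list_getD 0).comp Primrec.id (Primrec.fst.comp hpu)
  have hy := (Primrec.list_getD 0).comp Primrec.id (Primrec.snd.comp hpu)
  have ht := Primrec.encode.comp ((Primrec.decode (α := 𝕋)).comp hp)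
  have hm := Primrec.encode.comp ((Primrec.decode (α := 𝕄)).comp (Primrec.fst.comp hpu))
  have c : ∀ k : ℕ, Primrec fun _ : List ℕ => k := fun k => Primrec.const k
  have eqc : ∀ {f : List ℕ → ℕ} (k : ℕ), Primrec f → PrimrecPred fun L => f L = k :=
    fun k hf => Primrec.eq.comp hf (c k)
  have mk : ∀ {f : List ℕ → ℕ} (k : ℕ), Primrec f →
      Primrec fun L => Nat.pair k (f L) + 2 := fun k hf =>
    Primrec.succ.comp (Primrec.succ.comp (Primrec₂.natPair.comp (c k) hf))
  have pr : ∀ {f g : List ℕ → ℕ}, Primrec f → Primrec g →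
      Primrec fun L => Nat.pair (f L - 1) (g L - 1) := fun hf hg =>
    Primrec₂.natPair.comp (Primrec.pred.comp hf) (Primrec.pred.comp hg)
  unfold codeStep
  exact Primrec.ite (eqc 0 hlen) (c 0) <| Primrec.ite (eqc 0 htag) (c _) <|
    Primrec.ite (eqc 1 htag) (c _) <|
    Primrec.ite (eqc 2 htag) (Primrec.ite (eqc 0 ht) (c 0) (mk 2 (Primrec.pred.comp ht))) <|
    Primrec.ite (eqc 3 htag)
      (Primrec.ite (eqc 0 hm) (c 0) (Primrec.ite (eqc 0 hy) (c 0) (mk 3 (pr hm hy)))) <|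
    Primrec.ite (eqc 0 hx) (c 0) <| Primrec.ite (eqc 0 hy) (c 0) <|
    Primrec.ite (eqc 4 htag) (mk 4 (pr hx hy)) <|
    Primrec.ite (eqc 5 htag) (mk 5 (pr hx hy)) (mk 6 (pr hx hy))

instance instPrimcodable : Primcodable (Formula 𝕄 𝕋) where
  prim := by
    have h : Primrec₂ fun (_ : Unit) (n : ℕ) =>
        Encodable.encode (decodeNat n : Option (Formula 𝕄 𝕋)) :=
      Primrec.nat_strong_rec (g := fun _ L => some (codeStep 𝕄 𝕋 L)) _
        (Primrec.option_some.comp (primrec_codeStep.comp Primrec.snd)).to₂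
        (fun _ n => congrArg some (codeStep_eq n))
    exact Primrec.nat_iff.1 (h.comp (Primrec.const ()) Primrec.id)

end Coding

end Formula

/-! ### Unfolding axioms

A set of unfolding axioms is a set of pairs `(m, l)`, written `m ⇛ l` on paper. -/

/-- `m ⇛ m` is an axiom for every modality `m`. -/
def AxReflexive {𝕄 : Type u} (Ax : Set (𝕄 × List 𝕄)) : Prop :=
  ∀ m, (m, [m]) ∈ Ax

/-- If `m ⇛ l·n·l'` and `n ⇛ r` are axioms, then so is `m ⇛ l·r·l'`. -/
def AxTransitive {𝕄 : Type u} (Ax : Set (𝕄 × List 𝕄)) : Prop :=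
  ∀ m n l l' r, (m, l ++ n :: l') ∈ Ax → (n, r) ∈ Ax → (m, l ++ r ++ l') ∈ Ax

/-- `r` is a universal remainder of `m` after `n`: `m ⇛ n·r`, and `m ⇛ n·t·l` implies
`r ⇛ t·l`. -/
def IsRemainder {𝕄 : Type u} (Ax : Set (𝕄 × List 𝕄)) (m n r : 𝕄) : Prop :=
  (m, [n, r]) ∈ Ax ∧ ∀ t l, (m, n :: t :: l) ∈ Ax → (r, t :: l) ∈ Ax

/-- Whenever some `m ⇛ n·n'·l` is an axiom, `m` has a universal remainder after `n`. -/
def AxDecomposable {𝕄 : Type u} (Ax : Set (𝕄 × List 𝕄)) : Prop :=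
  ∀ m n n' l, (m, n :: n' :: l) ∈ Ax → ∃ r, IsRemainder Ax m n r

/-- The reflexive and transitive closure of a set of unfolding axioms, as a predicate. -/
inductive InClosure {𝕄 : Type u} (Ax : Set (𝕄 × List 𝕄)) : 𝕄 → List 𝕄 → Prop
  | base {m l} : (m, l) ∈ Ax → InClosure Ax m l
  | refl (m) : InClosure Ax m [m]
  | trans {m n l l' r} : InClosure Ax m (l ++ n :: l') → InClosure Ax n r →
      InClosure Ax m (l ++ r ++ l')

/-- The reflexive and transitive closure of a set of unfolding axioms. -/
def axClosure {𝕄 : Type u} (Ax : Set (𝕄 × List 𝕄)) : Set (𝕄 × List 𝕄) :=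
  {p | InClosure Ax p.1 p.2}

/-! ### The logic `L_Ax` -/

/-- Intuitionistic multimodal K with the unfolding axioms `Ax`: `Derivable Ax Γ A` says that the
sequent `Γ ⊢ A` is derivable. -/
inductive Derivable {𝕄 : Type u} {𝕋 : Type v} (Ax : Set (𝕄 × List 𝕄)) :
    Set (Formula 𝕄 𝕋) → Formula 𝕄 𝕋 → Prop
  | ax {Γ A} : A ∈ Γ → Derivable Ax Γ A
  | topI {Γ} : Derivable Ax Γ .top
  | botE {Γ A} : Derivable Ax Γ .bot → Derivable Ax Γ A
  | impE {Γ A B} : Derivable Ax Γ A → Derivable Ax Γ (.imp A B) → Derivable Ax Γ B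
  | impI {Γ A B} : Derivable Ax (insert A Γ) B → Derivable Ax Γ (.imp A B)
  | andE1 {Γ A B} : Derivable Ax Γ (.and A B) → Derivable Ax Γ A
  | andE2 {Γ A B} : Derivable Ax Γ (.and A B) → Derivable Ax Γ B
  | andI {Γ A B} : Derivable Ax Γ A → Derivable Ax Γ B → Derivable Ax Γ (.and A B)
  | orI1 {Γ A B} : Derivable Ax Γ A → Derivable Ax Γ (.or A B)
  | orI2 {Γ A B} : Derivable Ax Γ B → Derivable Ax Γ (.or A B)
  | orE {Γ A B C} : Derivable Ax Γ (.or A B) → Derivable Ax (insert A Γ) C →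
      Derivable Ax (insert B Γ) C → Derivable Ax Γ C
  | modal {Γ m B} (As : List (Formula 𝕄 𝕋)) : (∀ A ∈ As, Derivable Ax Γ (.box m A)) →
      Derivable Ax {A | A ∈ As} B → Derivable Ax Γ (.box m B)
  | unfold {Γ m l A} : Derivable Ax Γ (.box m A) → (m, l) ∈ Ax → Derivable Ax Γ (A.boxes l)

/-! ### The cut-free sequent calculus -/

/-- `sub` is a choice of the partial operation `⊖`: `sub m n` is defined exactly when some
`m ⇛ n·n'·l` is an axiom, and is then a universal remainder of `m` after `n`. -/
def IsSubtraction {𝕄 : Type u} (Ax : Set (𝕄 × List 𝕄)) (sub : 𝕄 → 𝕄 → Option 𝕄) : Prop :=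
  (∀ m n r, sub m n = some r → IsRemainder Ax m n r) ∧
    ∀ m n n' l, (m, n :: n' :: l) ∈ Ax → ∃ r, sub m n = some r

open Classical in
/-- The contribution of a single formula to `Γ ⊖ n`. -/
noncomputable def Formula.shift {𝕄 : Type u} {𝕋 : Type v} (Ax : Set (𝕄 × List 𝕄))
    (sub : 𝕄 → 𝕄 → Option 𝕄) (n : 𝕄) : Formula 𝕄 𝕋 → List (Formula 𝕄 𝕋)
  | .box m B => (if (m, [n]) ∈ Ax then [B] else []) ++ ((sub m n).map fun r => .box r B).toList
  | _ => []

/-- The flat context `Γ ⊖ n`. -/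
noncomputable def shiftContext {𝕄 : Type u} {𝕋 : Type v} (Ax : Set (𝕄 × List 𝕄))
    (sub : 𝕄 → 𝕄 → Option 𝕄) (n : 𝕄) (Γ : List (Formula 𝕄 𝕋)) : List (Formula 𝕄 𝕋) :=
  Γ.flatMap (Formula.shift Ax sub n)

/-- The cut-free sequent calculus. The principal formula of a left rule may stand anywhere in the
flat context. -/
inductive SeqProvable {𝕄 : Type u} {𝕋 : Type v} (Ax : Set (𝕄 × List 𝕄))
    (sub : 𝕄 → 𝕄 → Option 𝕄) : List (Formula 𝕄 𝕋) → Formula 𝕄 𝕋 → Prop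
  | var {Γ t} : .tok t ∈ Γ → SeqProvable Ax sub Γ (.tok t)
  | impR {Γ A B} : SeqProvable Ax sub (A :: Γ) B → SeqProvable Ax sub Γ (.imp A B)
  | impL {Γ A B D} : .imp A B ∈ Γ → SeqProvable Ax sub Γ A → SeqProvable Ax sub (B :: Γ) D →
      SeqProvable Ax sub Γ D
  | modR {Γ m A} : SeqProvable Ax sub (shiftContext Ax sub m Γ) A → SeqProvable Ax sub Γ (.box m A)
  | topR {Γ} : SeqProvable Ax sub Γ .top
  | botL {Γ A} : .bot ∈ Γ → SeqProvable Ax sub Γ A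
  | andL1 {Γ A B D} : .and A B ∈ Γ → SeqProvable Ax sub (A :: Γ) D → SeqProvable Ax sub Γ D
  | andL2 {Γ A B D} : .and A B ∈ Γ → SeqProvable Ax sub (B :: Γ) D → SeqProvable Ax sub Γ D
  | andR {Γ A B} : SeqProvable Ax sub Γ A → SeqProvable Ax sub Γ B →
      SeqProvable Ax sub Γ (.and A B)
  | orL {Γ A B D} : .or A B ∈ Γ → SeqProvable Ax sub (A :: Γ) D →
      SeqProvable Ax sub (B :: Γ) D → SeqProvable Ax sub Γ D
  | orR1 {Γ A B} : SeqProvable Ax sub Γ A → SeqProvable Ax sub Γ (.or A B)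
  | orR2 {Γ A B} : SeqProvable Ax sub Γ B → SeqProvable Ax sub Γ (.or A B)

/-! ### The Fitch-style lambda calculus -/

/-- An entry of a modal context: an assumption `x : A`, or a modal shift `{m}`. Variable names are
natural numbers. -/
inductive Entry (𝕄 : Type u) (𝕋 : Type v) : Type (max u v)
  | hyp : ℕ → Formula 𝕄 𝕋 → Entry 𝕄 𝕋
  | lock : 𝕄 → Entry 𝕄 𝕋

def Entry.equivSum (𝕄 : Type u) (𝕋 : Type v) : Entry 𝕄 𝕋 ≃ (ℕ × Formula 𝕄 𝕋) ⊕ 𝕄 where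
  toFun
    | .hyp x A => .inl (x, A)
    | .lock m => .inr m
  invFun
    | .inl (x, A) => .hyp x A
    | .inr m => .lock m
  left_inv e := by cases e <;> rfl
  right_inv e := by rcases e with ⟨x, A⟩ | m <;> rfl

instance Entry.instPrimcodable {𝕄 : Type u} {𝕋 : Type v} [Primcodable 𝕄] [Primcodable 𝕋] :
    Primcodable (Entry 𝕄 𝕋) :=
  Primcodable.ofEquiv _ (Entry.equivSum 𝕄 𝕋)

/-- Modal contexts. The most recent entry comes first, so `Γ, x : A` is `.hyp x A :: Γ`, and
`Γ, Δ` is `Δ ++ Γ`. -/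
abbrev Context (𝕄 : Type u) (𝕋 : Type v) : Type (max u v) := List (Entry 𝕄 𝕋)

/-- `[Γ]`: the modal shifts of a context, from the oldest to the most recent. -/
def Context.locks {𝕄 : Type u} {𝕋 : Type v} : Context 𝕄 𝕋 → List 𝕄
  | [] => []
  | .hyp _ _ :: Γ => Context.locks Γ
  | .lock m :: Γ => Context.locks Γ ++ [m]

/-- Raw lambda terms. -/
inductive LTerm (𝕄 : Type u) (𝕋 : Type v) : Type (max u v)
  | var : ℕ → LTerm 𝕄 𝕋
  | star : LTerm 𝕄 𝕋
  | abs : Formula 𝕄 𝕋 → LTerm 𝕄 𝕋 → LTerm 𝕄 𝕋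
  | lock : 𝕄 → LTerm 𝕄 𝕋 → LTerm 𝕄 𝕋
  | key : 𝕄 → List 𝕄 → LTerm 𝕄 𝕋 → LTerm 𝕄 𝕋
  | app : LTerm 𝕄 𝕋 → LTerm 𝕄 𝕋 → LTerm 𝕄 𝕋
  | lam : ℕ → Formula 𝕄 𝕋 → LTerm 𝕄 𝕋 → LTerm 𝕄 𝕋
  | fst : LTerm 𝕄 𝕋 → LTerm 𝕄 𝕋
  | snd : LTerm 𝕄 𝕋 → LTerm 𝕄 𝕋
  | pair : LTerm 𝕄 𝕋 → LTerm 𝕄 𝕋 → LTerm 𝕄 𝕋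
  | case : Formula 𝕄 𝕋 → LTerm 𝕄 𝕋 → ℕ → LTerm 𝕄 𝕋 → ℕ → LTerm 𝕄 𝕋 → LTerm 𝕄 𝕋
  | inl : LTerm 𝕄 𝕋 → LTerm 𝕄 𝕋
  | inr : LTerm 𝕄 𝕋 → LTerm 𝕄 𝕋

/-- The typing relation `Γ ⊢ P : A` of the Fitch-style lambda calculus. -/
inductive HasType {𝕄 : Type u} {𝕋 : Type v} (Ax : Set (𝕄 × List 𝕄)) :
    Context 𝕄 𝕋 → LTerm 𝕄 𝕋 → Formula 𝕄 𝕋 → Prop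
  | var {Γ Δ : Context 𝕄 𝕋} {x A} : Δ.locks = [] → HasType Ax (Δ ++ .hyp x A :: Γ) (.var x) A
  | star {Γ} : HasType Ax Γ .star .top
  | abs {Γ P A} : HasType Ax Γ P .bot → HasType Ax Γ (.abs A P) A
  | lock {Γ P m A} : HasType Ax (.lock m :: Γ) P A → HasType Ax Γ (.lock m P) (.box m A)
  | key {Γ Δ : Context 𝕄 𝕋} {P m l A} : HasType Ax Γ P (.box m A) → (m, l) ∈ Ax → Δ.locks = l →
      HasType Ax (Δ ++ Γ) (.key m l P) A
  | app {Γ P Q A B} : HasType Ax Γ P A → HasType Ax Γ Q (.imp A B) → HasType Ax Γ (.app P Q) B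
  | lam {Γ x P A B} : HasType Ax (.hyp x A :: Γ) P B → HasType Ax Γ (.lam x A P) (.imp A B)
  | fst {Γ P A B} : HasType Ax Γ P (.and A B) → HasType Ax Γ (.fst P) A
  | snd {Γ P A B} : HasType Ax Γ P (.and A B) → HasType Ax Γ (.snd P) B
  | pair {Γ P Q A B} : HasType Ax Γ P A → HasType Ax Γ Q B → HasType Ax Γ (.pair P Q) (.and A B)
  | case {Γ P Q R x y A B C} : HasType Ax (.hyp x A :: Γ) P C → HasType Ax (.hyp y B :: Γ) Q C →
      HasType Ax Γ R (.or A B) → HasType Ax Γ (.case C R x P y Q) C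
  | inl {Γ P A B} : HasType Ax Γ P A → HasType Ax Γ (.inl P) (.or A B)
  | inr {Γ P A B} : HasType Ax Γ P B → HasType Ax Γ (.inr P) (.or A B)

/-! ### Modalities and axioms for belief and interaction of agents -/

/-- The modalities over a set of agents: belief of `a`, the interaction `I_{a ← b}` in which `b`
makes claims to `a`, and the public modality. -/
inductive AgentModality (𝔸 : Type u) : Type u
  | belief : 𝔸 → AgentModality 𝔸
  | interaction : 𝔸 → 𝔸 → AgentModality 𝔸
  | pub : AgentModality 𝔸

def AgentModality.equivSum (𝔸 : Type u) : AgentModality 𝔸 ≃ (𝔸 ⊕ 𝔸 × 𝔸) ⊕ Unit where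
  toFun
    | .belief a => .inl (.inl a)
    | .interaction a b => .inl (.inr (a, b))
    | .pub => .inr ()
  invFun
    | .inl (.inl a) => .belief a
    | .inl (.inr (a, b)) => .interaction a b
    | .inr () => .pub
  left_inv e := by cases e <;> rfl
  right_inv e := by rcases e with (a | ⟨a, b⟩) | ⟨⟩ <;> rfl

instance AgentModality.instPrimcodable {𝔸 : Type u} [Primcodable 𝔸] :
    Primcodable (AgentModality 𝔸) :=
  Primcodable.ofEquiv _ (AgentModality.equivSum 𝔸)

/-- The unfolding axioms for belief, interaction, inheritance along a relation `le` on agents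
(`le a b`: agent `b` inherits the knowledge of `a`), and the public modality. -/
inductive AgentAxiom {𝔸 : Type u} (le : 𝔸 → 𝔸 → Prop) :
    AgentModality 𝔸 → List (AgentModality 𝔸) → Prop
  | selfAwareness (a) : AgentAxiom le (.belief a) [.belief a, .belief a]
  | recipientAwareness (a b) :
      AgentAxiom le (.interaction a b) [.belief a, .interaction a b]
  | intentOfClaim (a b) : AgentAxiom le (.interaction a b) [.interaction a b, .belief b]
  | beliefInheritance {a b} : le a b → AgentAxiom le (.belief a) [.belief b]
  | receiverInheritance {a b} (c) : le a b →
      AgentAxiom le (.interaction a c) [.interaction b c]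
  | senderInheritance {a b} (c) : le a b →
      AgentAxiom le (.interaction c a) [.interaction c b]
  | publicAwareness (m) : AgentAxiom le .pub [m, .pub]
  | publicVerifiability : AgentAxiom le .pub []

/-- The set of unfolding axioms for agents. -/
def agentAxioms {𝔸 : Type u} (le : 𝔸 → 𝔸 → Prop) :
    Set (AgentModality 𝔸 × List (AgentModality 𝔸)) :=
  {p | AgentAxiom le p.1 p.2}

end ModalLogic

open ModalLogic

/-! Decidability comes from a finite search space, and natural deduction and the lambda calculus are
reduced to a cut-free calculus that has one.

For a rule system whose premise lists are primitive recursive in the conclusion, provability is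
semi-decidable: search for a finite ranked derivation. Unprovability is witnessed by a finite set of
statements such that every rule concluding one of them has a premise dominated by a member of the
set. Such a witness exists when backward search stays in a finite set up to equivalence, and Post's
theorem then gives decidability (`computablePred_provable`). For sequents the finite set consists of
subformulas whose outermost modality may be replaced by any of the finitely many modalities. The
preorder comparing sequents is `Covers`: a context may grow, and an outermost modality may be
replaced by one that unfolds to it.

The calculus is taken with a parameter `E` of modalities that a left rule may strip. With `E` empty
it is the calculus of the theorem, which cannot prove `t` from `m t` even if `m ⇛ ε`. With `E` the
modalities unfolding to `ε` it is equivalent to `L_Ax`. The hard direction is a semantic cut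
elimination: formulas denote sets of contexts stable under the left rules, natural deduction is
sound for this reading (`sem_of_derivable`), and a context in the denotation of `A` proves `A`
without cut (`sem_of_mem_and_provable_of_sem`). Universality of the remainders `m ⊖ n` is what makes
shifting contexts monotone and compatible with unfolding.

A Fitch-style judgement is inhabited iff the formula obtained by discharging its whole context is a
theorem of `L_Ax` (`exists_hasType_iff`). For agents the closure of the axioms is described
explicitly, the remainders are read off from the description, and closing the axioms does not change
derivability. -/

namespace ModalLogic

universe u v

/-! ### Abstract rule systems: finite derivations, simulations, refutations -/

section Rules

variable {σ : Type u}

/-- The statements derivable from a set of rules, each with finitely many premises. -/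
inductive Provable (R : σ → List σ → Prop) : σ → Prop
  | step {q : σ} (i : List σ) : R q i → (∀ p ∈ i, Provable R p) → Provable R q

/-- `L` is a derivation: every element is the conclusion of a rule whose premises occur in `L`
with a smaller rank. -/
def IsRankedProof (R : σ → List σ → Prop) (L : List (ℕ × σ)) : Prop :=
  ∀ x ∈ L, ∃ i, R x.2 i ∧ ∀ p ∈ i, ∃ y ∈ L, y.1 < x.1 ∧ y.2 = p

/-- Premises have strictly smaller rank, so a list cannot justify its elements circularly, and
induction on the rank unfolds it into a derivation. -/
theorem IsRankedProof.provable {R : σ → List σ → Prop} {L : List (ℕ × σ)}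
    (hL : IsRankedProof R L) : ∀ x ∈ L, Provable R x.2 := by
  suffices h : ∀ n, ∀ x ∈ L, x.1 = n → Provable R x.2 from fun x hx => h _ x hx rfl
  intro n
  induction n using Nat.strong_induction_on with
  | _ n ih =>
    rintro x hx rfl
    obtain ⟨i, hi, h⟩ := hL x hx
    refine .step i hi fun p hp => ?_
    obtain ⟨y, hy, hlt, rfl⟩ := h p hp
    exact ih _ hlt y hy rfl

theorem IsRankedProof.append {R : σ → List σ → Prop} {L L' : List (ℕ × σ)}
    (h : IsRankedProof R L) (h' : IsRankedProof R L') : IsRankedProof R (L ++ L') := by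
  intro x hx
  rcases List.mem_append.1 hx with hx | hx
  · obtain ⟨i, hi, H⟩ := h x hx
    refine ⟨i, hi, fun p hp => ?_⟩
    obtain ⟨y, hy, H'⟩ := H p hp
    exact ⟨y, List.mem_append_left _ hy, H'⟩
  · obtain ⟨i, hi, H⟩ := h' x hx
    refine ⟨i, hi, fun p hp => ?_⟩
    obtain ⟨y, hy, H'⟩ := H p hp
    exact ⟨y, List.mem_append_right _ hy, H'⟩

/-- Derivations of the separate premises can be concatenated. The bound `n` on the ranks is the rank
that a conclusion drawn from them may receive. -/
theorem exists_isRankedProof_list {R : σ → List σ → Prop} (i : List σ)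
    (h : ∀ p ∈ i, ∃ L, IsRankedProof R L ∧ ∃ y ∈ L, y.2 = p) :
    ∃ L n, IsRankedProof R L ∧ ∀ p ∈ i, ∃ y ∈ L, y.1 < n ∧ y.2 = p := by
  induction i with
  | nil => exact ⟨[], 0, by simp [IsRankedProof], by simp⟩
  | cons p i ih =>
    obtain ⟨L, n, hL, H⟩ := ih fun q hq => h q (List.mem_cons_of_mem _ hq)
    obtain ⟨L', hL', y, hy, rfl⟩ := h p List.mem_cons_self
    refine ⟨L ++ L', n + y.1 + 1, hL.append hL', fun q hq => ?_⟩
    rcases List.mem_cons.1 hq with rfl | hq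
    · exact ⟨y, List.mem_append_right _ hy, by omega, rfl⟩
    · obtain ⟨z, hz, hlt, rfl⟩ := H q hq
      exact ⟨z, List.mem_append_left _ hz, by omega, rfl⟩

theorem Provable.exists_isRankedProof {R : σ → List σ → Prop} {q : σ} (h : Provable R q) :
    ∃ L, IsRankedProof R L ∧ ∃ y ∈ L, y.2 = q := by
  induction h with
  | @step q i hi _ ih =>
    obtain ⟨L, n, hL, H⟩ := exists_isRankedProof_list i ih
    refine ⟨(n, q) :: L, ?_, (n, q), List.mem_cons_self, rfl⟩
    intro x hx
    rcases List.mem_cons.1 hx with rfl | hx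
    · refine ⟨i, hi, fun p hp => ?_⟩
      obtain ⟨y, hy, H'⟩ := H p hp
      exact ⟨y, List.mem_cons_of_mem _ hy, H'⟩
    · obtain ⟨j, hj, H'⟩ := hL x hx
      refine ⟨j, hj, fun p hp => ?_⟩
      obtain ⟨y, hy, H''⟩ := H' p hp
      exact ⟨y, List.mem_cons_of_mem _ hy, H''⟩

/-- `le` is a simulation for the rules: every rule with conclusion `q` can be weakened to one with
conclusion `q'` if `le q q'`. -/
def IsSimulation (R : σ → List σ → Prop) (le : σ → σ → Prop) : Prop :=
  ∀ q q' i, le q q' → R q i → ∃ i', R q' i' ∧ ∀ p' ∈ i', ∃ p ∈ i, le p p'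

theorem Provable.mono {R : σ → List σ → Prop} {le : σ → σ → Prop} (hs : IsSimulation R le)
    {q : σ} (h : Provable R q) : ∀ q', le q q' → Provable R q' := by
  induction h with
  | @step q i hi _ ih =>
    intro q' hq
    obtain ⟨i', hi', H⟩ := hs q q' i hq hi
    refine .step i' hi' fun p' hp' => ?_
    obtain ⟨p, hp, hle⟩ := H p' hp'
    exact ih p hp p' hle

/-- `L` refutes its elements: every rule that concludes one of them has a premise that is below
an element of `L`. -/
def IsRefutation (R : σ → List σ → Prop) (c : σ → σ → Prop) (L : List σ) : Prop :=
  ∀ q ∈ L, ∀ i, R q i → ∃ p ∈ i, ∃ p' ∈ L, c p p'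

/-- Induction on a supposed derivation of `q`: the simulation transports its last rule to `q'`, and
the refutation then leads to a premise again below an element of `L`. Because `L` meets premises
only up to `le`, the induction must range over everything below `L`, not over `L` alone. -/
theorem IsRefutation.not_provable {R : σ → List σ → Prop} {le c : σ → σ → Prop}
    (hs : IsSimulation R le) (hc : ∀ p p', c p p' → le p p')
    (htrans : ∀ p q r, le p q → le q r → le p r) {L : List σ} (hL : IsRefutation R c L)
    {q q' : σ} (hq : le q q') (hq' : q' ∈ L) : ¬ Provable R q := by
  intro h
  induction h generalizing q' with
  | @step q i hi _ ih =>
    obtain ⟨i', hi', H⟩ := hs q q' i hq hi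
    obtain ⟨p', hp', p'', hp'', hc'⟩ := hL q' hq' i' hi'
    obtain ⟨p, hp, hle⟩ := H p' hp'
    exact ih p hp (htrans _ _ _ hle (hc _ _ hc')) hp''

end Rules

/-! ### Recursive enumerability and the decidability criterion -/

theorem rePred_exists {α : Type u} {β : Type v} [Primcodable α] [Primcodable β]
    {R : α → β → Prop} (hR : PrimrecRel R) : REPred fun a => ∃ b, R a b := by
  classical
  obtain ⟨_, hR⟩ := hR
  let f : α → ℕ → Option Unit := fun a n =>
    (Encodable.decode (α := β) n).bind fun b => if R a b then some () else none
  have hf : Primrec₂ f := by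
    refine Primrec.option_bind (Primrec.decode.comp Primrec.snd) ?_
    refine Primrec.ite ?_ (Primrec.const _) (Primrec.const _)
    exact PrimrecPred.comp ⟨_, hR⟩ (Primrec.pair (Primrec.fst.comp Primrec.fst) Primrec.snd)
  refine (Partrec.dom_re (Partrec.rfindOpt hf.to_comp)).of_eq fun a => ?_
  rw [Nat.rfindOpt_dom]
  constructor
  · rintro ⟨n, x, hx⟩
    simp only [f, Option.mem_def, Option.bind_eq_some_iff] at hx
    obtain ⟨b, -, hb⟩ := hx
    by_cases h : R a b
    · exact ⟨b, h⟩
    · simp [h] at hb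
  · rintro ⟨b, hb⟩
    exact ⟨Encodable.encode b, (), by simp [f, hb]⟩

section RulesComputable

variable {σ : Type u} [Primcodable σ]

theorem primrecPred_isRankedProof {prem : σ → List (List σ)} (hprem : Primrec prem) :
    PrimrecPred (IsRankedProof fun q i => i ∈ prem q) := by
  classical
  have h1 : PrimrecRel fun (y : ℕ × σ) (z : (ℕ × σ) × σ) => y.1 < z.1.1 ∧ y.2 = z.2 := by
    refine PrimrecPred.and ?_ ?_
    · exact Primrec.nat_lt.comp (Primrec.fst.comp Primrec.fst)
        (Primrec.fst.comp (Primrec.fst.comp Primrec.snd))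
    · exact Primrec.eq.comp (Primrec.snd.comp Primrec.fst) (Primrec.snd.comp Primrec.snd)
  have h2 : PrimrecRel fun (p : σ) (z : List (ℕ × σ) × (ℕ × σ)) =>
      ∃ y ∈ z.1, y.1 < z.2.1 ∧ y.2 = p :=
    h1.exists_mem_list.comp (Primrec.fst.comp Primrec.snd)
      (Primrec.pair (Primrec.snd.comp Primrec.snd) Primrec.fst)
  have h3 : PrimrecRel fun (x : ℕ × σ) (L : List (ℕ × σ)) =>
      ∃ i ∈ prem x.2, ∀ p ∈ i, ∃ y ∈ L, y.1 < x.1 ∧ y.2 = p :=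
    h2.forall_mem_list.exists_mem_list.comp (hprem.comp (Primrec.snd.comp Primrec.fst))
      (Primrec.pair Primrec.snd Primrec.fst)
  exact h3.forall_mem_list.comp Primrec.id Primrec.id

theorem primrecPred_isRefutation {prem : σ → List (List σ)} (hprem : Primrec prem)
    {c : σ → σ → Prop} (hc : PrimrecRel c) :
    PrimrecPred (IsRefutation (fun q i => i ∈ prem q) c) := by
  have h1 : PrimrecRel fun (p : σ) (L : List σ) => ∃ p' ∈ L, c p p' :=
    (PrimrecRel.exists_mem_list (R := fun p' p => c p p') (hc.comp Primrec.snd Primrec.fst)).comp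
      Primrec.snd Primrec.fst
  have h2 : PrimrecRel fun (q : σ) (L : List σ) =>
      ∀ i ∈ prem q, ∃ p ∈ i, ∃ p' ∈ L, c p p' :=
    h1.exists_mem_list.forall_mem_list.comp (hprem.comp Primrec.fst) Primrec.snd
  exact h2.forall_mem_list.comp Primrec.id Primrec.id

/-- Provability is decidable if, up to a decidable simulation, only finitely many statements can
be reached from each statement by applying the rules backwards. -/
theorem computablePred_provable {prem : σ → List (List σ)} (hprem : Primrec prem)
    {le c : σ → σ → Prop} (hc : PrimrecRel c) (hcle : ∀ p p', c p p' → le p p')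
    (htrans : ∀ p q r, le p q → le q r → le p r)
    (hs : IsSimulation (fun q i => i ∈ prem q) le)
    (hfin : ∀ s, ∃ L : List σ, (∃ s' ∈ L, c s s' ∧ le s' s) ∧
      ∀ q ∈ L, ∀ i ∈ prem q, ∀ p ∈ i, ∃ p' ∈ L, c p p' ∧ le p' p) :
    ComputablePred (Provable fun q i => i ∈ prem q) := by
  classical
  -- Post's theorem: derivations enumerate the provable statements, refutations the unprovable ones.
  rw [ComputablePred.computable_iff_re_compl_re']
  constructor
  · have h1 : PrimrecRel fun (s : σ) (L : List (ℕ × σ)) => ∃ y ∈ L, y.2 = s :=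
      (PrimrecRel.exists_mem_list (R := fun (y : ℕ × σ) s => y.2 = s)
        (Primrec.eq.comp (Primrec.snd.comp Primrec.fst) Primrec.snd)).comp
        Primrec.snd Primrec.fst
    have h2 : PrimrecRel fun (s : σ) (L : List (ℕ × σ)) =>
        IsRankedProof (fun q i => i ∈ prem q) L ∧ ∃ y ∈ L, y.2 = s :=
      PrimrecPred.and ((primrecPred_isRankedProof hprem).comp Primrec.snd) h1
    refine (rePred_exists h2).of_eq fun s => ⟨?_, fun h => h.exists_isRankedProof⟩
    rintro ⟨L, hL, y, hy, rfl⟩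
    exact hL.provable y hy
  · have h1 : PrimrecRel fun (s : σ) (L : List σ) => ∃ s' ∈ L, c s s' :=
      (PrimrecRel.exists_mem_list (R := fun p' p => c p p')
        (hc.comp Primrec.snd Primrec.fst)).comp Primrec.snd Primrec.fst
    have h2 : PrimrecRel fun (s : σ) (L : List σ) =>
        IsRefutation (fun q i => i ∈ prem q) c L ∧ ∃ s' ∈ L, c s s' :=
      PrimrecPred.and ((primrecPred_isRefutation hprem hc).comp Primrec.snd) h1
    refine (rePred_exists h2).of_eq fun s => ⟨?_, fun h => ?_⟩
    · rintro ⟨L, hL, s', hs', h⟩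
      exact hL.not_provable hs hcle htrans (hcle _ _ h) hs'
    · obtain ⟨L, ⟨s', hs', hcs, hle⟩, hL⟩ := hfin s
      have up : ∀ p p', ¬ Provable (fun q i => i ∈ prem q) p → le p' p →
          ¬ Provable (fun q i => i ∈ prem q) p' := fun p p' hp hle hp' => hp (hp'.mono hs _ hle)
      -- The unprovable members of the search space form the refutation: a rule concluding one of
      -- them has an unprovable premise, and the representative of that premise in `L` is unprovable
      -- too. This choice is not effective, but only existence matters.
      refine ⟨L.filter fun q => ¬ Provable (fun q i => i ∈ prem q) q, ?_, s', ?_, hcs⟩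
      · intro q hq i hi
        simp only [List.mem_filter, decide_eq_true_eq] at hq
        by_contra! H
        refine hq.2 (.step i hi fun p hp => ?_)
        by_contra hn
        obtain ⟨p', hp', hcp, hle'⟩ := hL q hq.1 i hi p hp
        exact H p hp p' (by simpa using ⟨hp', up _ _ hn hle'⟩) hcp
      · simpa using ⟨hs', up _ _ h hle⟩

end RulesComputable

/-! ### Primitive recursive constructors and destructors of formulas -/

namespace Formula

variable {𝕄 : Type u} {𝕋 : Type v}

/-- The sides of an implication. -/
def asImp : Formula 𝕄 𝕋 → Option (Formula 𝕄 𝕋 × Formula 𝕄 𝕋)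
  | imp A B => some (A, B)
  | _ => none

/-- The sides of a conjunction. -/
def asAnd : Formula 𝕄 𝕋 → Option (Formula 𝕄 𝕋 × Formula 𝕄 𝕋)
  | and A B => some (A, B)
  | _ => none

/-- The sides of a disjunction. -/
def asOr : Formula 𝕄 𝕋 → Option (Formula 𝕄 𝕋 × Formula 𝕄 𝕋)
  | or A B => some (A, B)
  | _ => none

/-- The modality and the body of a modal formula. -/
def asBox : Formula 𝕄 𝕋 → Option (𝕄 × Formula 𝕄 𝕋)
  | box m A => some (m, A)
  | _ => none

/-- Whether a formula is a token. -/
def isTok : Formula 𝕄 𝕋 → Bool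
  | tok _ => true
  | _ => false

theorem asImp_eq_some {F A B : Formula 𝕄 𝕋} : F.asImp = some (A, B) ↔ F = imp A B := by
  cases F <;> simp [asImp]

theorem asAnd_eq_some {F A B : Formula 𝕄 𝕋} : F.asAnd = some (A, B) ↔ F = and A B := by
  cases F <;> simp [asAnd]

theorem asOr_eq_some {F A B : Formula 𝕄 𝕋} : F.asOr = some (A, B) ↔ F = or A B := by
  cases F <;> simp [asOr]

theorem asBox_eq_some {F A : Formula 𝕄 𝕋} {m : 𝕄} : F.asBox = some (m, A) ↔ F = box m A := by
  cases F <;> simp [asBox]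

theorem isTok_iff {F : Formula 𝕄 𝕋} : F.isTok = true ↔ ∃ t, F = tok t := by
  cases F <;> simp [isTok]

variable [Primcodable 𝕄] [Primcodable 𝕋]

theorem primrec_unpair_code : Primrec fun A : Formula 𝕄 𝕋 => (A.code - 1).unpair :=
  Primrec.unpair.comp (Primrec.pred.comp Primrec.encode)

/-- A code is one plus a pair of tag and payload, and the payload of a compound formula is exactly
the standard code of the pair of its components. Each destructor is thus a test of the tag followed
by decoding. -/
theorem primrec_decode_payload {β : Type*} [Primcodable β] (k : ℕ) :
    Primrec fun A : Formula 𝕄 𝕋 =>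
      if (A.code - 1).unpair.1 = k then Encodable.decode (α := β) (A.code - 1).unpair.2
      else none :=
  Primrec.ite (Primrec.eq.comp (Primrec.fst.comp primrec_unpair_code) (Primrec.const k))
    (Primrec.decode.comp (Primrec.snd.comp primrec_unpair_code)) (Primrec.const none)

theorem decode_pair_code (A B : Formula 𝕄 𝕋) :
    Encodable.decode (α := Formula 𝕄 𝕋 × Formula 𝕄 𝕋) (Nat.pair A.code B.code) = some (A, B) :=
  Encodable.encodek (A, B)

theorem decode_pair_encode_code (m : 𝕄) (A : Formula 𝕄 𝕋) :
    Encodable.decode (α := 𝕄 × Formula 𝕄 𝕋) (Nat.pair (Encodable.encode m) A.code) =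
      some (m, A) :=
  Encodable.encodek (m, A)

theorem primrec_asImp : Primrec (asImp : Formula 𝕄 𝕋 → _) :=
  (primrec_decode_payload 4).of_eq fun A => by
    cases A <;> simp [code, asImp, decode_pair_code, -Encodable.decode_prod_val]

theorem primrec_asAnd : Primrec (asAnd : Formula 𝕄 𝕋 → _) :=
  (primrec_decode_payload 5).of_eq fun A => by
    cases A <;> simp [code, asAnd, decode_pair_code, -Encodable.decode_prod_val]

theorem primrec_asOr : Primrec (asOr : Formula 𝕄 𝕋 → _) :=
  (primrec_decode_payload 6).of_eq fun A => by
    cases A <;> simp [code, asOr, decode_pair_code, -Encodable.decode_prod_val]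

theorem primrec_asBox : Primrec (asBox : Formula 𝕄 𝕋 → _) :=
  (primrec_decode_payload 3).of_eq fun A => by
    cases A <;> simp [code, asBox, decode_pair_encode_code, -Encodable.decode_prod_val]

theorem primrec_isTok : Primrec (isTok : Formula 𝕄 𝕋 → _) :=
  (Primrec.eq.comp (Primrec.fst.comp primrec_unpair_code) (Primrec.const 2)).decide.of_eq
    fun A => by cases A <;> simp [code, isTok]

theorem primrec_imp : Primrec₂ (imp : Formula 𝕄 𝕋 → Formula 𝕄 𝕋 → Formula 𝕄 𝕋) :=
  Primrec₂.encode_iff.1 <| Primrec.succ.comp₂ <| Primrec₂.natPair.comp₂ (Primrec₂.const 4) <|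
    Primrec₂.natPair.comp₂ (Primrec.encode.comp₂ Primrec₂.left)
      (Primrec.encode.comp₂ Primrec₂.right)

theorem primrec_box : Primrec₂ (box : 𝕄 → Formula 𝕄 𝕋 → Formula 𝕄 𝕋) :=
  Primrec₂.encode_iff.1 <| Primrec.succ.comp₂ <| Primrec₂.natPair.comp₂ (Primrec₂.const 3) <|
    Primrec₂.natPair.comp₂ (Primrec.encode.comp₂ Primrec₂.left)
      (Primrec.encode.comp₂ Primrec₂.right)

end Formula

/-! ### Sequent rules as a primitive recursive list of premises -/

/-- Sequents with a flat context. -/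
abbrev Sequent (𝕄 : Type u) (𝕋 : Type v) : Type (max u v) := List (Formula 𝕄 𝕋) × Formula 𝕄 𝕋

/-- The rules of the cut-free sequent calculus, together with a left rule that removes the
modalities in `E`. -/
inductive Rule {𝕄 : Type u} {𝕋 : Type v} (Ax : Set (𝕄 × List 𝕄)) (sub : 𝕄 → 𝕄 → Option 𝕄)
    (E : Set 𝕄) : Sequent 𝕄 𝕋 → List (Sequent 𝕄 𝕋) → Prop
  | var {Γ t} : .tok t ∈ Γ → Rule Ax sub E (Γ, .tok t) []
  | impR {Γ A B} : Rule Ax sub E (Γ, .imp A B) [(A :: Γ, B)]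
  | impL {Γ A B D} : .imp A B ∈ Γ → Rule Ax sub E (Γ, D) [(Γ, A), (B :: Γ, D)]
  | modR {Γ m A} : Rule Ax sub E (Γ, .box m A) [(shiftContext Ax sub m Γ, A)]
  | topR {Γ} : Rule Ax sub E (Γ, .top) []
  | botL {Γ A} : .bot ∈ Γ → Rule Ax sub E (Γ, A) []
  | andL1 {Γ A B D} : .and A B ∈ Γ → Rule Ax sub E (Γ, D) [(A :: Γ, D)]
  | andL2 {Γ A B D} : .and A B ∈ Γ → Rule Ax sub E (Γ, D) [(B :: Γ, D)]
  | andR {Γ A B} : Rule Ax sub E (Γ, .and A B) [(Γ, A), (Γ, B)]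
  | orL {Γ A B D} : .or A B ∈ Γ → Rule Ax sub E (Γ, D) [(A :: Γ, D), (B :: Γ, D)]
  | orR1 {Γ A B} : Rule Ax sub E (Γ, .or A B) [(Γ, A)]
  | orR2 {Γ A B} : Rule Ax sub E (Γ, .or A B) [(Γ, B)]
  | boxL {Γ m A D} : .box m A ∈ Γ → m ∈ E → Rule Ax sub E (Γ, D) [(A :: Γ, D)]

section Premises

variable {𝕄 : Type u} {𝕋 : Type v} (Ax : Set (𝕄 × List 𝕄)) (sub : 𝕄 → 𝕄 → Option 𝕄)
  (E : Set 𝕄)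

open Classical in
/-- The left rules with principal formula `F`. -/
noncomputable def leftPremises (s : Sequent 𝕄 𝕋) (F : Formula 𝕄 𝕋) : List (List (Sequent 𝕄 𝕋)) :=
  (if F = .bot then [[]] else []) ++
  (F.asImp.toList.map fun p => [(s.1, p.1), (p.2 :: s.1, s.2)]) ++
  (F.asAnd.toList.flatMap fun p => [[(p.1 :: s.1, s.2)], [(p.2 :: s.1, s.2)]]) ++
  (F.asOr.toList.map fun p => [(p.1 :: s.1, s.2), (p.2 :: s.1, s.2)]) ++
  (F.asBox.toList.flatMap fun p => if p.1 ∈ E then [[(p.2 :: s.1, s.2)]] else [])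

open Classical in
/-- The right rules. -/
noncomputable def rightPremises (s : Sequent 𝕄 𝕋) : List (List (Sequent 𝕄 𝕋)) :=
  (if s.2 = .top then [[]] else []) ++
  (if s.2.isTok = true ∧ ∃ F ∈ s.1, F = s.2 then [[]] else []) ++
  (s.2.asImp.toList.map fun p => [(p.1 :: s.1, p.2)]) ++
  (s.2.asAnd.toList.map fun p => [(s.1, p.1), (s.1, p.2)]) ++
  (s.2.asOr.toList.flatMap fun p => [[(s.1, p.1)], [(s.1, p.2)]]) ++
  (s.2.asBox.toList.map fun p => [(shiftContext Ax sub p.1 s.1, p.2)])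

/-- The lists of premises of all the rules with a given conclusion. -/
noncomputable def premises (s : Sequent 𝕄 𝕋) : List (List (Sequent 𝕄 𝕋)) :=
  rightPremises Ax sub s ++ s.1.flatMap (leftPremises E s)

variable {Ax sub E}

theorem mem_premises {s : Sequent 𝕄 𝕋} {i : List (Sequent 𝕄 𝕋)} :
    i ∈ premises Ax sub E s ↔ Rule Ax sub E s i := by
  obtain ⟨Γ, C⟩ := s
  simp only [premises, rightPremises, leftPremises, List.mem_append, List.mem_flatMap,
    List.mem_map, Option.mem_toList, Prod.exists, Formula.asImp_eq_some, Formula.asAnd_eq_some,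
    Formula.asOr_eq_some, Formula.asBox_eq_some, Formula.isTok_iff, List.mem_ite_nil_right,
    List.mem_cons, List.not_mem_nil, or_false, exists_eq_right]
  constructor
  · rintro ((((((⟨rfl, rfl⟩ | ⟨⟨⟨t, rfl⟩, h⟩, rfl⟩) | ⟨A, B, rfl, rfl⟩) | ⟨A, B, rfl, rfl⟩) |
      ⟨A, B, rfl, rfl | rfl⟩) | ⟨m, A, rfl, rfl⟩) |
      ⟨F, hF, ((((⟨rfl, rfl⟩ | ⟨A, B, rfl, rfl⟩) | ⟨A, B, rfl, rfl | rfl⟩) |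
      ⟨A, B, rfl, rfl⟩) | ⟨m, A, rfl, hm, rfl⟩)⟩)
    · exact .topR
    · exact .var h
    · exact .impR
    · exact .andR
    · exact .orR1
    · exact .orR2
    · exact .modR
    · exact .botL hF
    · exact .impL hF
    · exact .andL1 hF
    · exact .andL2 hF
    · exact .orL hF
    · exact .boxL hF hm
  · intro h
    cases h with
    | var h => simp [h]
    | impR => simp
    | impL h => exact .inr ⟨_, h, by simp⟩
    | modR => simp
    | topR => simp
    | botL h => exact .inr ⟨_, h, by simp⟩
    | andL1 h => exact .inr ⟨_, h, by simp⟩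
    | andL2 h => exact .inr ⟨_, h, by simp⟩
    | andR => simp
    | orL h => exact .inr ⟨_, h, by simp⟩
    | orR1 => simp
    | orR2 => simp
    | boxL h hm => exact .inr ⟨_, h, by simp [hm]⟩

/-- Replaces the case distinction on formulas by list operations on a destructor, to which closure
properties of primitive recursion apply. -/
theorem shift_eq (n : 𝕄) (F : Formula 𝕄 𝕋) : open Classical in
    F.shift Ax sub n = F.asBox.toList.flatMap fun p =>
      (if (p.1, [n]) ∈ Ax then [p.2] else []) ++
        (sub p.1 n).toList.map fun r => .box r p.2 := by
  cases F <;> simp [Formula.shift, Formula.asBox]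
  cases sub _ n <;> simp

variable [Finite 𝕄] [Primcodable 𝕄] [Primcodable 𝕋]

/-- This is why `Ax` may be an arbitrary, even undecidable, set: the rules consult it only through
`m ⇛ n`, the table of `sub`, and `E`, each a finite amount of data. -/
theorem primrecPred_of_finite {α : Type*} [Finite α] [Primcodable α] (p : α → Prop) :
    PrimrecPred p := by
  classical exact ⟨inferInstance, Primrec.dom_finite _⟩

theorem primrec_shift : Primrec₂ (Formula.shift (𝕋 := 𝕋) Ax sub) := by
  classical
  have h : Primrec fun x : 𝕄 × Formula 𝕄 𝕋 => x.2.asBox.toList.flatMap fun p =>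
      (if (p.1, [x.1]) ∈ Ax then [p.2] else []) ++
        (sub p.1 x.1).toList.map fun r => Formula.box r p.2 := by
    have hm : Primrec fun y : (𝕄 × Formula 𝕄 𝕋) × (𝕄 × Formula 𝕄 𝕋) => (y.2.1, y.1.1) :=
      Primrec.pair (Primrec.fst.comp Primrec.snd) (Primrec.fst.comp Primrec.fst)
    have hB : Primrec fun y : (𝕄 × Formula 𝕄 𝕋) × (𝕄 × Formula 𝕄 𝕋) => y.2.2 :=
      Primrec.snd.comp Primrec.snd
    refine Primrec.list_flatMap (Primrec.optionToList.comp (Formula.primrec_asBox.comp Primrec.snd))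
      (Primrec.list_append.comp ?_ ?_)
    · exact Primrec.ite ((primrecPred_of_finite fun q : 𝕄 × 𝕄 => (q.1, [q.2]) ∈ Ax).comp hm)
        (Primrec.list_cons.comp hB (Primrec.const [])) (Primrec.const [])
    · refine Primrec.list_map (Primrec.optionToList.comp
        ((Primrec.dom_finite fun q : 𝕄 × 𝕄 => sub q.1 q.2).comp hm)) ?_
      exact Formula.primrec_box.comp Primrec.snd (hB.comp Primrec.fst)
  exact h.of_eq fun x => (shift_eq x.1 x.2).symm

theorem primrec_shiftContext : Primrec₂ (shiftContext (𝕋 := 𝕋) Ax sub) :=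
  Primrec.list_flatMap Primrec.snd
    (primrec_shift.comp (Primrec.fst.comp Primrec.fst) Primrec.snd).to₂

theorem primrec_leftPremises : Primrec₂ (leftPremises (𝕋 := 𝕋) E) := by
  classical
  have hΓ : Primrec fun y : (Sequent 𝕄 𝕋 × Formula 𝕄 𝕋) × (Formula 𝕄 𝕋 × Formula 𝕄 𝕋) =>
    y.1.1.1 := Primrec.fst.comp (Primrec.fst.comp Primrec.fst)
  have hC : Primrec fun y : (Sequent 𝕄 𝕋 × Formula 𝕄 𝕋) × (Formula 𝕄 𝕋 × Formula 𝕄 𝕋) =>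
    y.1.1.2 := Primrec.snd.comp (Primrec.fst.comp Primrec.fst)
  have h1 : Primrec fun y : (Sequent 𝕄 𝕋 × Formula 𝕄 𝕋) × (Formula 𝕄 𝕋 × Formula 𝕄 𝕋) =>
    y.2.1 := Primrec.fst.comp Primrec.snd
  have h2 : Primrec fun y : (Sequent 𝕄 𝕋 × Formula 𝕄 𝕋) × (Formula 𝕄 𝕋 × Formula 𝕄 𝕋) =>
    y.2.2 := Primrec.snd.comp Primrec.snd
  have nil : ∀ {α β : Type (max u v)} [Primcodable α] [Primcodable β],
    Primrec fun _ : α => ([] : List β) := Primrec.const []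
  have p1 := Primrec.pair (Primrec.list_cons.comp h1 hΓ) hC
  have p2 := Primrec.pair (Primrec.list_cons.comp h2 hΓ) hC
  refine Primrec.list_append.comp (Primrec.list_append.comp (Primrec.list_append.comp
    (Primrec.list_append.comp ?_ ?_) ?_) ?_) ?_
  · exact Primrec.ite (Primrec.eq.comp Primrec.snd (Primrec.const _)) (Primrec.const _)
      (Primrec.const _)
  · exact Primrec.list_map
      (Primrec.optionToList.comp (Formula.primrec_asImp.comp Primrec.snd))
      (Primrec.list_cons.comp (Primrec.pair hΓ h1) (Primrec.list_cons.comp p2 nil))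
  · exact Primrec.list_flatMap
      (Primrec.optionToList.comp (Formula.primrec_asAnd.comp Primrec.snd))
      (Primrec.list_cons.comp (Primrec.list_cons.comp p1 nil)
        (Primrec.list_cons.comp (Primrec.list_cons.comp p2 nil) nil))
  · exact Primrec.list_map
      (Primrec.optionToList.comp (Formula.primrec_asOr.comp Primrec.snd))
      (Primrec.list_cons.comp p1 (Primrec.list_cons.comp p2 nil))
  · refine Primrec.list_flatMap
      (Primrec.optionToList.comp (Formula.primrec_asBox.comp Primrec.snd)) ?_
    refine Primrec.ite ((primrecPred_of_finite (· ∈ E)).comp (Primrec.fst.comp Primrec.snd)) ?_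
      (Primrec.const _)
    exact Primrec.list_cons.comp (Primrec.list_cons.comp (Primrec.pair (Primrec.list_cons.comp
      (Primrec.snd.comp Primrec.snd) (Primrec.fst.comp (Primrec.fst.comp Primrec.fst)))
      (Primrec.snd.comp (Primrec.fst.comp Primrec.fst))) (Primrec.const []))
      (Primrec.const [])

theorem primrec_rightPremises : Primrec (rightPremises (𝕋 := 𝕋) Ax sub) := by
  classical
  have hΓ : Primrec fun y : Sequent 𝕄 𝕋 × (Formula 𝕄 𝕋 × Formula 𝕄 𝕋) => y.1.1 :=
    Primrec.fst.comp Primrec.fst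
  have h1 : Primrec fun y : Sequent 𝕄 𝕋 × (Formula 𝕄 𝕋 × Formula 𝕄 𝕋) => y.2.1 :=
    Primrec.fst.comp Primrec.snd
  have h2 : Primrec fun y : Sequent 𝕄 𝕋 × (Formula 𝕄 𝕋 × Formula 𝕄 𝕋) => y.2.2 :=
    Primrec.snd.comp Primrec.snd
  have nil : ∀ {α β : Type (max u v)} [Primcodable α] [Primcodable β],
    Primrec fun _ : α => ([] : List β) := Primrec.const []
  refine Primrec.list_append.comp (Primrec.list_append.comp (Primrec.list_append.comp
    (Primrec.list_append.comp (Primrec.list_append.comp ?_ ?_) ?_) ?_) ?_) ?_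
  · exact Primrec.ite (Primrec.eq.comp Primrec.snd (Primrec.const _)) (Primrec.const _)
      (Primrec.const _)
  · refine Primrec.ite (PrimrecPred.and ?_ ?_) (Primrec.const _) (Primrec.const _)
    · exact Primrec.eq.comp (Formula.primrec_isTok.comp Primrec.snd) (Primrec.const _)
    · exact (PrimrecRel.exists_mem_list (R := fun F C : Formula 𝕄 𝕋 => F = C) Primrec.eq).comp
        Primrec.fst Primrec.snd
  · exact Primrec.list_map (Primrec.optionToList.comp (Formula.primrec_asImp.comp Primrec.snd))
      (Primrec.list_cons.comp (Primrec.pair (Primrec.list_cons.comp h1 hΓ) h2) nil)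
  · exact Primrec.list_map (Primrec.optionToList.comp (Formula.primrec_asAnd.comp Primrec.snd))
      (Primrec.list_cons.comp (Primrec.pair hΓ h1)
        (Primrec.list_cons.comp (Primrec.pair hΓ h2) nil))
  · exact Primrec.list_flatMap (Primrec.optionToList.comp (Formula.primrec_asOr.comp Primrec.snd))
      (Primrec.list_cons.comp (Primrec.list_cons.comp (Primrec.pair hΓ h1) nil)
        (Primrec.list_cons.comp (Primrec.list_cons.comp (Primrec.pair hΓ h2) nil) nil))
  · exact Primrec.list_map (Primrec.optionToList.comp (Formula.primrec_asBox.comp Primrec.snd))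
      (Primrec.list_cons.comp (Primrec.pair (primrec_shiftContext.comp
        (Primrec.fst.comp Primrec.snd) (Primrec.fst.comp Primrec.fst))
        (Primrec.snd.comp Primrec.snd)) (Primrec.const []))

theorem primrec_premises : Primrec (premises (𝕋 := 𝕋) Ax sub E) :=
  Primrec.list_append.comp primrec_rightPremises
    (Primrec.list_flatMap Primrec.fst primrec_leftPremises)

end Premises

/-! ### The covering order on contexts and the finite search space -/

section

variable {𝕄 : Type u} {𝕋 : Type v} {Ax : Set (𝕄 × List 𝕄)} {sub : 𝕄 → 𝕄 → Option 𝕄} {E : Set 𝕄}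

theorem AxTransitive.comp (ht : AxTransitive Ax) {m n : 𝕄} {l : List 𝕄} (h : (m, [n]) ∈ Ax)
    (h' : (n, l) ∈ Ax) : (m, l) ∈ Ax := by
  simpa using ht m n [] [] l h h'

theorem IsSubtraction.exists_remainder (hs : IsSubtraction Ax sub) {m n t : 𝕄} {l : List 𝕄}
    (h : (m, n :: t :: l) ∈ Ax) : ∃ q, sub m n = some q ∧ (q, t :: l) ∈ Ax := by
  obtain ⟨q, hq⟩ := hs.2 _ _ _ _ h
  exact ⟨q, hq, (hs.1 _ _ _ hq).2 _ _ h⟩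

theorem IsSubtraction.mem (hs : IsSubtraction Ax sub) {m n q : 𝕄} (h : sub m n = some q) :
    (m, [n, q]) ∈ Ax := (hs.1 _ _ _ h).1

theorem mem_shiftContext {n : 𝕄} {Γ : List (Formula 𝕄 𝕋)} {F : Formula 𝕄 𝕋} :
    F ∈ shiftContext Ax sub n Γ ↔ ∃ m B, Formula.box m B ∈ Γ ∧
      ((m, [n]) ∈ Ax ∧ F = B ∨ ∃ r, sub m n = some r ∧ F = .box r B) := by
  simp only [shiftContext, List.mem_flatMap]
  constructor
  · rintro ⟨G, hG, h⟩
    cases G <;> simp only [Formula.shift, List.not_mem_nil] at h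
    rename_i m B
    refine ⟨m, B, hG, ?_⟩
    simpa [eq_comm] using h
  · rintro ⟨m, B, hB, h⟩
    refine ⟨_, hB, ?_⟩
    simpa [Formula.shift, eq_comm] using h

/-- `Γ` covers `Δ` if every formula of `Δ` is in `Γ`, up to replacing its outermost modality by
one that unfolds to it. -/
def Covers (Ax : Set (𝕄 × List 𝕄)) (Γ Δ : List (Formula 𝕄 𝕋)) : Prop :=
  ∀ B ∈ Δ, B ∈ Γ ∨ ∃ r r' C, B = .box r' C ∧ .box r C ∈ Γ ∧ (r, [r']) ∈ Ax

theorem Covers.of_subset {Γ Δ : List (Formula 𝕄 𝕋)} (h : Δ ⊆ Γ) : Covers Ax Γ Δ :=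
  fun _ hB => .inl (h hB)

theorem Covers.refl (Γ : List (Formula 𝕄 𝕋)) : Covers Ax Γ Γ := .of_subset (List.Subset.refl _)

theorem covers_cons (A : Formula 𝕄 𝕋) (Γ : List (Formula 𝕄 𝕋)) : Covers Ax (A :: Γ) Γ :=
  .of_subset (List.subset_cons_self _ _)

theorem Covers.trans (ht : AxTransitive Ax) {Γ Δ Θ : List (Formula 𝕄 𝕋)} (h : Covers Ax Γ Δ)
    (h' : Covers Ax Δ Θ) : Covers Ax Γ Θ := by
  intro B hB
  rcases h' B hB with hB | ⟨r, r', C, rfl, hC, hr⟩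
  · exact h B hB
  · rcases h _ hC with hC | ⟨q, q', D, hD, hq, hqr⟩
    · exact .inr ⟨r, r', C, rfl, hC, hr⟩
    · obtain ⟨rfl, rfl⟩ := Formula.box.inj hD
      exact .inr ⟨q, r', C, rfl, hq, ht.comp hqr hr⟩

theorem Covers.cons {Γ Δ : List (Formula 𝕄 𝕋)} (h : Covers Ax Γ Δ) (A : Formula 𝕄 𝕋) :
    Covers Ax (A :: Γ) (A :: Δ) := by
  intro B hB
  rcases List.mem_cons.1 hB with rfl | hB
  · exact .inl List.mem_cons_self
  · rcases h B hB with hB | ⟨r, r', C, h1, h2, h3⟩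
    · exact .inl (List.mem_cons_of_mem _ hB)
    · exact .inr ⟨r, r', C, h1, List.mem_cons_of_mem _ h2, h3⟩

theorem Covers.mem {Γ Δ : List (Formula 𝕄 𝕋)} (h : Covers Ax Γ Δ) {A : Formula 𝕄 𝕋} (hA : A ∈ Δ)
    (hb : ∀ m B, A ≠ .box m B) : A ∈ Γ := by
  rcases h A hA with hA | ⟨r, r', C, rfl, -⟩
  · exact hA
  · exact absurd rfl (hb _ _)

theorem Covers.exists_box (hr : AxReflexive Ax) {Γ Δ : List (Formula 𝕄 𝕋)} (h : Covers Ax Γ Δ)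
    {m : 𝕄} {A : Formula 𝕄 𝕋} (hA : .box m A ∈ Δ) : ∃ r, .box r A ∈ Γ ∧ (r, [m]) ∈ Ax := by
  rcases h _ hA with hA | ⟨r, r', C, e, h1, h2⟩
  · exact ⟨m, hA, hr m⟩
  · obtain ⟨rfl, rfl⟩ := Formula.box.inj e
    exact ⟨r, h1, h2⟩

/-- If `r ⇛ k` and `k ⇛ m·q`, then `m ⇛ n` gives `r ⇛ n·q`, so the universal remainder of `r` after
`n` exists and unfolds to `q`. Stripped bodies survive by composing unfoldings. -/
theorem Covers.shiftContext (hr : AxReflexive Ax) (ht : AxTransitive Ax)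
    (hs : IsSubtraction Ax sub) {Γ Δ : List (Formula 𝕄 𝕋)} (h : Covers Ax Γ Δ) {m n : 𝕄}
    (hm : (m, [n]) ∈ Ax) : Covers Ax (shiftContext Ax sub n Γ) (shiftContext Ax sub m Δ) := by
  intro F hF
  obtain ⟨k, B, hB, hF⟩ := mem_shiftContext.1 hF
  obtain ⟨r, hrB, hrk⟩ := h.exists_box hr hB
  rcases hF with ⟨hk, rfl⟩ | ⟨q, hq, rfl⟩
  · exact .inl (mem_shiftContext.2 ⟨r, F, hrB, .inl ⟨ht.comp hrk (ht.comp hk hm), rfl⟩⟩)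
  · have h1 : (r, n :: q :: []) ∈ Ax := by
      simpa using ht r m [] [q] [n] (ht.comp hrk (hs.mem hq)) hm
    obtain ⟨q', hq', h2⟩ := hs.exists_remainder h1
    exact .inr ⟨q', q, B, rfl, mem_shiftContext.2 ⟨r, B, hrB, .inr ⟨q', hq', rfl⟩⟩, h2⟩

/-- Substituting `m ⇛ n·r` into `k ⇛ m` or `k ⇛ m·q` produces lists that begin with `n·r`.
Universality, used once for `n` and in the second case once more for `r`, turns these into what the
iterated shift contains. -/
theorem covers_shiftContext_shiftContext (ht : AxTransitive Ax) (hs : IsSubtraction Ax sub)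
    (Γ : List (Formula 𝕄 𝕋)) {m n r : 𝕄} (hm : (m, [n, r]) ∈ Ax) :
    Covers Ax (shiftContext Ax sub r (shiftContext Ax sub n Γ)) (shiftContext Ax sub m Γ) := by
  intro F hF
  obtain ⟨k, B, hB, hF⟩ := mem_shiftContext.1 hF
  rcases hF with ⟨hk, rfl⟩ | ⟨q, hq, rfl⟩
  · obtain ⟨s, hs1, hs2⟩ := hs.exists_remainder (ht.comp hk hm)
    exact .inl (mem_shiftContext.2 ⟨s, F, mem_shiftContext.2 ⟨k, F, hB, .inr ⟨s, hs1, rfl⟩⟩,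
      .inl ⟨hs2, rfl⟩⟩)
  · have h1 : (k, n :: r :: [q]) ∈ Ax := by simpa using ht k m [] [q] [n, r] (hs.mem hq) hm
    obtain ⟨s, hs1, hs2⟩ := hs.exists_remainder h1
    obtain ⟨q', hq1, hq2⟩ := hs.exists_remainder hs2
    exact .inr ⟨q', q, B, rfl, mem_shiftContext.2 ⟨s, B, mem_shiftContext.2
      ⟨k, B, hB, .inr ⟨s, hs1, rfl⟩⟩, .inr ⟨q', hq1, rfl⟩⟩, hq2⟩

/-- The order on sequents by the strength of the context. -/
def Sequent.Weaker (Ax : Set (𝕄 × List 𝕄)) (s s' : Sequent 𝕄 𝕋) : Prop :=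
  Covers Ax s'.1 s.1 ∧ s.2 = s'.2

/-- The same rule applies to the stronger context: principal formulas that are not modal must
literally occur there, and for stripping a modality `E` has to be closed under passing to modalities
that unfold into it. -/
theorem isSimulation_weaker (hr : AxReflexive Ax) (ht : AxTransitive Ax)
    (hs : IsSubtraction Ax sub) (hE : ∀ m n, (m, [n]) ∈ Ax → n ∈ E → m ∈ E) :
    IsSimulation (Rule (𝕋 := 𝕋) Ax sub E) (Sequent.Weaker Ax) := by
  rintro ⟨Γ, C⟩ ⟨Γ', C'⟩ i ⟨h, e⟩ hi
  dsimp only at h e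
  subst e
  have one : ∀ {Γ Γ' : List (Formula 𝕄 𝕋)} {A : Formula 𝕄 𝕋}, Covers Ax Γ' Γ →
      ∀ p' ∈ [(Γ', A)], ∃ p ∈ [(Γ, A)], Sequent.Weaker Ax p p' := fun h => by
    simpa [Sequent.Weaker] using h
  have two : ∀ {Γ Γ' Δ Δ' : List (Formula 𝕄 𝕋)} {A B : Formula 𝕄 𝕋}, Covers Ax Γ' Γ →
      Covers Ax Δ' Δ →
      ∀ p' ∈ [(Γ', A), (Δ', B)], ∃ p ∈ [(Γ, A), (Δ, B)], Sequent.Weaker Ax p p' := fun h h' => by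
    simp only [List.mem_cons, List.not_mem_nil, or_false, forall_eq_or_imp, forall_eq]
    exact ⟨⟨_, .inl rfl, h, rfl⟩, ⟨_, .inr rfl, h', rfl⟩⟩
  cases hi with
  | var ht => exact ⟨_, .var (h.mem ht (by simp)), by simp⟩
  | impR => exact ⟨_, .impR, one (h.cons _)⟩
  | impL hA => exact ⟨_, .impL (h.mem hA (by simp)), two h (h.cons _)⟩
  | modR => exact ⟨_, .modR, one (h.shiftContext hr ht hs (hr _))⟩
  | topR => exact ⟨_, .topR, by simp⟩
  | botL hb => exact ⟨_, .botL (h.mem hb (by simp)), by simp⟩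
  | andL1 hA => exact ⟨_, .andL1 (h.mem hA (by simp)), one (h.cons _)⟩
  | andL2 hA => exact ⟨_, .andL2 (h.mem hA (by simp)), one (h.cons _)⟩
  | andR => exact ⟨_, .andR, two h h⟩
  | orL hA => exact ⟨_, .orL (h.mem hA (by simp)), two (h.cons _) (h.cons _)⟩
  | orR1 => exact ⟨_, .orR1, one h⟩
  | orR2 => exact ⟨_, .orR2, one h⟩
  | boxL hA hm =>
    obtain ⟨r, h1, h2⟩ := h.exists_box hr hA
    exact ⟨_, .boxL h1 (hE _ _ h2 hm), one (h.cons _)⟩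

/-- A set of formulas closed under everything that the rules of the sequent calculus can produce
from its elements. -/
structure IsSubformulaClosed (U : Set (Formula 𝕄 𝕋)) : Prop where
  imp : ∀ {A B}, .imp A B ∈ U → A ∈ U ∧ B ∈ U
  and : ∀ {A B}, .and A B ∈ U → A ∈ U ∧ B ∈ U
  or : ∀ {A B}, .or A B ∈ U → A ∈ U ∧ B ∈ U
  box : ∀ {m A}, .box m A ∈ U → A ∈ U ∧ ∀ r, .box r A ∈ U

theorem IsSubformulaClosed.union {U V : Set (Formula 𝕄 𝕋)} (hU : IsSubformulaClosed U)
    (hV : IsSubformulaClosed V) : IsSubformulaClosed (U ∪ V) where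
  imp h := h.elim (fun h => ⟨.inl (hU.imp h).1, .inl (hU.imp h).2⟩)
    fun h => ⟨.inr (hV.imp h).1, .inr (hV.imp h).2⟩
  and h := h.elim (fun h => ⟨.inl (hU.and h).1, .inl (hU.and h).2⟩)
    fun h => ⟨.inr (hV.and h).1, .inr (hV.and h).2⟩
  or h := h.elim (fun h => ⟨.inl (hU.or h).1, .inl (hU.or h).2⟩)
    fun h => ⟨.inr (hV.or h).1, .inr (hV.or h).2⟩
  box h := h.elim (fun h => ⟨.inl (hU.box h).1, fun r => .inl ((hU.box h).2 r)⟩)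
    fun h => ⟨.inr (hV.box h).1, fun r => .inr ((hV.box h).2 r)⟩

/-- Shifts may exchange an outermost modality but never lengthen a prefix, so adjoining `r A` for
the finitely many `r` at each modal subformula suffices. -/
theorem exists_finite_isSubformulaClosed [Finite 𝕄] (A : Formula 𝕄 𝕋) :
    ∃ U : Set (Formula 𝕄 𝕋), U.Finite ∧ IsSubformulaClosed U ∧ A ∈ U := by
  -- Handles the three binary connectives uniformly.
  have bin : ∀ F A B : Formula 𝕄 𝕋, (∀ m C, F ≠ .box m C) →
      (∀ C D, (F = .imp C D ∨ F = .and C D ∨ F = .or C D) → C = A ∧ D = B) →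
      (∃ U : Set (Formula 𝕄 𝕋), U.Finite ∧ IsSubformulaClosed U ∧ A ∈ U) →
      (∃ U : Set (Formula 𝕄 𝕋), U.Finite ∧ IsSubformulaClosed U ∧ B ∈ U) →
      ∃ U : Set (Formula 𝕄 𝕋), U.Finite ∧ IsSubformulaClosed U ∧ F ∈ U := by
    rintro F A B hF hF' ⟨U, hU, hU', hA⟩ ⟨V, hV, hV', hB⟩
    have hW := hU'.union hV'
    have key : ∀ C D, (F = .imp C D ∨ F = .and C D ∨ F = .or C D) →
        C ∈ insert F (U ∪ V) ∧ D ∈ insert F (U ∪ V) := fun C D h => by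
      obtain ⟨rfl, rfl⟩ := hF' C D h
      exact ⟨.inr (.inl hA), .inr (.inr hB)⟩
    refine ⟨insert F (U ∪ V), (hU.union hV).insert _, ⟨?_, ?_, ?_, ?_⟩, .inl rfl⟩
    · rintro C D (h | h)
      · exact key C D (.inl h.symm)
      · exact ⟨.inr (hW.imp h).1, .inr (hW.imp h).2⟩
    · rintro C D (h | h)
      · exact key C D (.inr (.inl h.symm))
      · exact ⟨.inr (hW.and h).1, .inr (hW.and h).2⟩
    · rintro C D (h | h)
      · exact key C D (.inr (.inr h.symm))
      · exact ⟨.inr (hW.or h).1, .inr (hW.or h).2⟩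
    · rintro m C (h | h)
      · exact absurd h.symm (hF _ _)
      · exact ⟨.inr (hW.box h).1, fun r => .inr ((hW.box h).2 r)⟩
  have atom : ∀ F : Formula 𝕄 𝕋, (∀ m C, F ≠ .box m C) →
      (∀ C D, ¬ (F = .imp C D ∨ F = .and C D ∨ F = .or C D)) →
      ∃ U : Set (Formula 𝕄 𝕋), U.Finite ∧ IsSubformulaClosed U ∧ F ∈ U := by
    intro F hF hF'
    refine ⟨{F}, Set.finite_singleton F, ⟨?_, ?_, ?_, ?_⟩, rfl⟩
    · rintro C D h
      exact absurd (.inl h.symm) (hF' C D)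
    · rintro C D h
      exact absurd (.inr (.inl h.symm)) (hF' C D)
    · rintro C D h
      exact absurd (.inr (.inr h.symm)) (hF' C D)
    · rintro m C h
      exact absurd h.symm (hF m C)
  induction A with
  | top => exact atom _ (by simp) (by simp)
  | bot => exact atom _ (by simp) (by simp)
  | tok t => exact atom _ (by simp) (by simp)
  | imp A B hA hB => exact bin _ A B (by simp) (by simp +contextual) hA hB
  | and A B hA hB => exact bin _ A B (by simp) (by simp +contextual) hA hB
  | or A B hA hB => exact bin _ A B (by simp) (by simp +contextual) hA hB
  | box m A hA =>
    obtain ⟨U, hU, hU', hA⟩ := hA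
    refine ⟨U ∪ Set.range fun r => .box r A, hU.union (Set.finite_range _), ⟨?_, ?_, ?_, ?_⟩,
      .inr ⟨m, rfl⟩⟩
    · rintro C D (h | ⟨r, hr⟩)
      · exact ⟨.inl (hU'.imp h).1, .inl (hU'.imp h).2⟩
      · simp at hr
    · rintro C D (h | ⟨r, hr⟩)
      · exact ⟨.inl (hU'.and h).1, .inl (hU'.and h).2⟩
      · simp at hr
    · rintro C D (h | ⟨r, hr⟩)
      · exact ⟨.inl (hU'.or h).1, .inl (hU'.or h).2⟩
      · simp at hr
    · rintro n C (h | ⟨r, hr⟩)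
      · exact ⟨.inl (hU'.box h).1, fun r => .inl ((hU'.box h).2 r)⟩
      · obtain ⟨rfl, rfl⟩ := Formula.box.inj hr
        exact ⟨.inl hA, fun r => .inr ⟨r, rfl⟩⟩

theorem exists_finite_isSubformulaClosed_list [Finite 𝕄] (Γ : List (Formula 𝕄 𝕋)) :
    ∃ U : Set (Formula 𝕄 𝕋), U.Finite ∧ IsSubformulaClosed U ∧ ∀ A ∈ Γ, A ∈ U := by
  induction Γ with
  | nil => exact ⟨∅, Set.finite_empty, ⟨by simp, by simp, by simp, by simp⟩, by simp⟩
  | cons A Γ ih =>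
    obtain ⟨U, hU, hU', hΓ⟩ := ih
    obtain ⟨V, hV, hV', hA⟩ := exists_finite_isSubformulaClosed A
    refine ⟨V ∪ U, hV.union hU, hV'.union hU', fun B hB => ?_⟩
    rcases List.mem_cons.1 hB with rfl | hB
    · exact .inl hA
    · exact .inr (hΓ B hB)

theorem IsSubformulaClosed.rule {U : Set (Formula 𝕄 𝕋)} (hU : IsSubformulaClosed U)
    {s : Sequent 𝕄 𝕋} {i : List (Sequent 𝕄 𝕋)} (h : Rule Ax sub E s i) (hΓ : ∀ A ∈ s.1, A ∈ U)
    (hC : s.2 ∈ U) : ∀ p ∈ i, (∀ A ∈ p.1, A ∈ U) ∧ p.2 ∈ U := by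
  cases h with
  | var => simp
  | impR => simpa using ⟨⟨(hU.imp hC).1, hΓ⟩, (hU.imp hC).2⟩
  | impL h => simpa using ⟨⟨hΓ, (hU.imp (hΓ _ h)).1⟩, ⟨(hU.imp (hΓ _ h)).2, hΓ⟩, hC⟩
  | modR =>
    simp only [List.mem_cons, List.not_mem_nil, or_false, forall_eq]
    refine ⟨fun F hF => ?_, (hU.box hC).1⟩
    obtain ⟨k, B, hB, ⟨-, rfl⟩ | ⟨q, -, rfl⟩⟩ := mem_shiftContext.1 hF
    · exact (hU.box (hΓ _ hB)).1
    · exact (hU.box (hΓ _ hB)).2 q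
  | topR => simp
  | botL => simp
  | andL1 h => simpa using ⟨⟨(hU.and (hΓ _ h)).1, hΓ⟩, hC⟩
  | andL2 h => simpa using ⟨⟨(hU.and (hΓ _ h)).2, hΓ⟩, hC⟩
  | andR => simpa using ⟨⟨hΓ, (hU.and hC).1⟩, hΓ, (hU.and hC).2⟩
  | orL h => simpa using ⟨⟨⟨(hU.or (hΓ _ h)).1, hΓ⟩, hC⟩, ⟨(hU.or (hΓ _ h)).2, hΓ⟩, hC⟩
  | orR1 => simpa using ⟨hΓ, (hU.or hC).1⟩
  | orR2 => simpa using ⟨hΓ, (hU.or hC).2⟩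
  | boxL h hm => simpa using ⟨⟨(hU.box (hΓ _ h)).1, hΓ⟩, hC⟩

/-- Keeping `E` a parameter lets one argument serve both the plain cut-free calculus and the variant
complete for `L_Ax`. -/
theorem computablePred_provable_rule [Finite 𝕄] [Primcodable 𝕄] [Primcodable 𝕋]
    (hr : AxReflexive Ax) (ht : AxTransitive Ax) (hs : IsSubtraction Ax sub)
    (hE : ∀ m n, (m, [n]) ∈ Ax → n ∈ E → m ∈ E) :
    ComputablePred (Provable (Rule (𝕋 := 𝕋) Ax sub E)) := by
  classical
  have hR : (fun q i => i ∈ premises (𝕋 := 𝕋) Ax sub E q) = Rule Ax sub E := by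
    funext q i
    exact propext mem_premises
  -- Plain inclusion of contexts suffices as the decidable comparison; the coarser covering order is
  -- only needed as the transitive simulation above it.
  have hc : PrimrecRel fun s s' : Sequent 𝕄 𝕋 => (∀ A ∈ s.1, ∃ B ∈ s'.1, B = A) ∧ s.2 = s'.2 := by
    have h1 : PrimrecRel fun (A : Formula 𝕄 𝕋) (Γ : List (Formula 𝕄 𝕋)) => ∃ B ∈ Γ, B = A :=
      (PrimrecRel.exists_mem_list (R := fun B A : Formula 𝕄 𝕋 => B = A) Primrec.eq).comp
        Primrec.snd Primrec.fst
    exact PrimrecPred.and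
      (h1.forall_mem_list.comp (Primrec.fst.comp Primrec.fst) (Primrec.fst.comp Primrec.snd))
      (Primrec.eq.comp (Primrec.snd.comp Primrec.fst) (Primrec.snd.comp Primrec.snd))
  rw [← hR]
  refine computablePred_provable primrec_premises (le := Sequent.Weaker Ax) hc ?_ ?_ ?_ ?_
  · rintro p p' ⟨h, e⟩
    exact ⟨.of_subset fun A hA => by simpa using h A hA, e⟩
  · rintro p q r ⟨h, e⟩ ⟨h', e'⟩
    exact ⟨h'.trans ht h, e.trans e'⟩
  · rw [hR]
    exact isSimulation_weaker hr ht hs hE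
  · rintro ⟨Γ, C⟩
    obtain ⟨U, hU, hU', hΓ⟩ := exists_finite_isSubformulaClosed_list (C :: Γ)
    let V := hU.toFinset.toList
    have hV : ∀ A, A ∈ V ↔ A ∈ U := by simp [V]
    have key : ∀ s : Sequent 𝕄 𝕋, (∀ A ∈ s.1, A ∈ U) → s.2 ∈ U →
        ∃ s' ∈ V.sublists ×ˢ V, ((∀ A ∈ s.1, ∃ B ∈ s'.1, B = A) ∧ s.2 = s'.2) ∧
          Sequent.Weaker Ax s' s := by
      intro s h1 h2
      -- The representative forgets order and multiplicity: it lists the members of `V` that occur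
      -- in the context, so it is one of finitely many sublists.
      refine ⟨(V.filter (· ∈ s.1), s.2), ?_, ⟨?_, rfl⟩, .of_subset ?_, rfl⟩
      · simp [hV, h2]
      · intro A hA
        exact ⟨A, by simp [hV, hA, h1 A hA], rfl⟩
      · intro A hA
        simpa using (List.mem_filter.1 hA).2
    refine ⟨V.sublists ×ˢ V, key _ (fun A hA => hΓ A (List.mem_cons_of_mem _ hA))
      (hΓ C List.mem_cons_self), ?_⟩
    rintro ⟨Δ, D⟩ hq i hi p hp
    simp only [List.mem_product, List.mem_sublists] at hq
    obtain ⟨h1, h2⟩ := hU'.rule (mem_premises.1 hi)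
      (fun A hA => (hV A).1 (hq.1.subset hA)) ((hV D).1 hq.2) p hp
    exact key p h1 h2

theorem _root_.List.forall_mem_pair {α : Type*} {p : α → Prop} {a b : α} :
    (∀ x ∈ [a, b], p x) ↔ p a ∧ p b := by simp

theorem provable_rule_empty_iff {s : Sequent 𝕄 𝕋} :
    Provable (Rule Ax sub ∅) s ↔ SeqProvable Ax sub s.1 s.2 := by
  constructor
  · intro h
    induction h with
    | @step q i hi _ ih =>
      cases hi with
      | var h => exact .var h
      | impR => exact .impR (ih (_, _) (List.mem_singleton_self _))
      | impL h => exact .impL h (List.forall_mem_pair.1 ih).1 (List.forall_mem_pair.1 ih).2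
      | modR => exact .modR (ih (_, _) (List.mem_singleton_self _))
      | topR => exact .topR
      | botL h => exact .botL h
      | andL1 h => exact .andL1 h (ih (_, _) (List.mem_singleton_self _))
      | andL2 h => exact .andL2 h (ih (_, _) (List.mem_singleton_self _))
      | andR => exact .andR (List.forall_mem_pair.1 ih).1 (List.forall_mem_pair.1 ih).2
      | orL h => exact .orL h (List.forall_mem_pair.1 ih).1 (List.forall_mem_pair.1 ih).2
      | orR1 => exact .orR1 (ih (_, _) (List.mem_singleton_self _))
      | orR2 => exact .orR2 (ih (_, _) (List.mem_singleton_self _))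
      | boxL _ hm => exact hm.elim
  · obtain ⟨Γ, C⟩ := s
    intro h
    dsimp only at h
    induction h with
    | var h => exact .step _ (.var h) (by simp)
    | impR _ ih => exact .step _ .impR (by simpa using ih)
    | impL h _ _ ih ih' => exact .step _ (.impL h) (by simpa using ⟨ih, ih'⟩)
    | modR _ ih => exact .step _ .modR (by simpa using ih)
    | topR => exact .step _ .topR (by simp)
    | botL h => exact .step _ (.botL h) (by simp)
    | andL1 h _ ih => exact .step _ (.andL1 h) (by simpa using ih)
    | andL2 h _ ih => exact .step _ (.andL2 h) (by simpa using ih)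
    | andR _ _ ih ih' => exact .step _ .andR (by simpa using ⟨ih, ih'⟩)
    | orL h _ _ ih ih' => exact .step _ (.orL h) (by simpa using ⟨ih, ih'⟩)
    | orR1 _ ih => exact .step _ .orR1 (by simpa using ih)
    | orR2 _ ih => exact .step _ .orR2 (by simpa using ih)

theorem computablePred_seqProvable [Finite 𝕄] [Primcodable 𝕄] [Primcodable 𝕋]
    (hr : AxReflexive Ax) (ht : AxTransitive Ax) (hs : IsSubtraction Ax sub) :
    ComputablePred fun s : List (Formula 𝕄 𝕋) × Formula 𝕄 𝕋 => SeqProvable Ax sub s.1 s.2 :=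
  (computablePred_provable_rule hr ht hs fun _ _ _ h => h.elim).of_eq
    fun _ => provable_rule_empty_iff

end

/-! ### Semantic cut elimination for natural deduction -/

section

variable {𝕄 : Type u} {𝕋 : Type v} {Ax : Set (𝕄 × List 𝕄)} {sub : 𝕄 → 𝕄 → Option 𝕄} {E : Set 𝕄}

/-- Closure of a set of contexts under the left rules of the sequent calculus. -/
inductive LeftClosure (Ax : Set (𝕄 × List 𝕄)) (sub : 𝕄 → 𝕄 → Option 𝕄) (E : Set 𝕄)
    (X : List (Formula 𝕄 𝕋) → Prop) : List (Formula 𝕄 𝕋) → Prop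
  | base {Γ} : X Γ → LeftClosure Ax sub E X Γ
  | impL {Γ A B} : .imp A B ∈ Γ → Provable (Rule Ax sub E) (Γ, A) →
      LeftClosure Ax sub E X (B :: Γ) → LeftClosure Ax sub E X Γ
  | botL {Γ} : .bot ∈ Γ → LeftClosure Ax sub E X Γ
  | andL1 {Γ A B} : .and A B ∈ Γ → LeftClosure Ax sub E X (A :: Γ) → LeftClosure Ax sub E X Γ
  | andL2 {Γ A B} : .and A B ∈ Γ → LeftClosure Ax sub E X (B :: Γ) → LeftClosure Ax sub E X Γ
  | orL {Γ A B} : .or A B ∈ Γ → LeftClosure Ax sub E X (A :: Γ) →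
      LeftClosure Ax sub E X (B :: Γ) → LeftClosure Ax sub E X Γ
  | boxL {Γ m A} : .box m A ∈ Γ → m ∈ E → LeftClosure Ax sub E X (A :: Γ) →
      LeftClosure Ax sub E X Γ

namespace LeftClosure

variable {X Y : List (Formula 𝕄 𝕋) → Prop}

/-- Makes the left closure idempotent and monotone in `X`: left rules already applied are kept and
continued at the leaves. -/
theorem bind {Γ : List (Formula 𝕄 𝕋)} (h : LeftClosure Ax sub E X Γ)
    (hXY : ∀ Γ, X Γ → LeftClosure Ax sub E Y Γ) : LeftClosure Ax sub E Y Γ := by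
  induction h with
  | base h => exact hXY _ h
  | impL h h' _ ih => exact .impL h h' ih
  | botL h => exact .botL h
  | andL1 h _ ih => exact .andL1 h ih
  | andL2 h _ ih => exact .andL2 h ih
  | orL h _ _ ih ih' => exact .orL h ih ih'
  | boxL h h' _ ih => exact .boxL h h' ih

end LeftClosure

/-- Sets of contexts closed under strengthening and under the left rules. -/
structure IsStable (Ax : Set (𝕄 × List 𝕄)) (sub : 𝕄 → 𝕄 → Option 𝕄) (E : Set 𝕄)
    (X : List (Formula 𝕄 𝕋) → Prop) : Prop where
  mono : ∀ Γ Γ', Covers Ax Γ' Γ → X Γ → X Γ'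
  closed : ∀ Γ, LeftClosure Ax sub E X Γ → X Γ

/-- The data of a sequent calculus for `Ax`: the modalities in `E` are those that unfold to the
empty list. -/
structure IsUnfoldingCalculus (Ax : Set (𝕄 × List 𝕄)) (sub : 𝕄 → 𝕄 → Option 𝕄) (E : Set 𝕄) :
    Prop where
  refl : AxReflexive Ax
  trans : AxTransitive Ax
  sub : IsSubtraction Ax sub
  mem_iff : ∀ m, m ∈ E ↔ (m, []) ∈ Ax

namespace IsUnfoldingCalculus

theorem upward (h : IsUnfoldingCalculus Ax sub E) (m n : 𝕄) (hm : (m, [n]) ∈ Ax) (hn : n ∈ E) :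
    m ∈ E :=
  (h.mem_iff m).2 (h.trans.comp hm ((h.mem_iff n).1 hn))

theorem provable_mono (h : IsUnfoldingCalculus Ax sub E) {Γ Γ' : List (Formula 𝕄 𝕋)}
    {A : Formula 𝕄 𝕋} (hΓ : Covers Ax Γ' Γ) (hA : Provable (Rule Ax sub E) (Γ, A)) :
    Provable (Rule Ax sub E) (Γ', A) :=
  hA.mono (isSimulation_weaker h.refl h.trans h.sub h.upward) _ ⟨hΓ, rfl⟩

theorem leftClosure_mono (h : IsUnfoldingCalculus Ax sub E) {X : List (Formula 𝕄 𝕋) → Prop}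
    (hX : ∀ Γ Γ', Covers Ax Γ' Γ → X Γ → X Γ') {Γ Γ' : List (Formula 𝕄 𝕋)}
    (hΓ : Covers Ax Γ' Γ) (hA : LeftClosure Ax sub E X Γ) : LeftClosure Ax sub E X Γ' := by
  induction hA generalizing Γ' with
  | base h => exact .base (hX _ _ hΓ h)
  | impL h1 h2 _ ih =>
    exact .impL (hΓ.mem h1 (by simp)) (h.provable_mono hΓ h2) (ih (hΓ.cons _))
  | botL h1 => exact .botL (hΓ.mem h1 (by simp))
  | andL1 h1 _ ih => exact .andL1 (hΓ.mem h1 (by simp)) (ih (hΓ.cons _))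
  | andL2 h1 _ ih => exact .andL2 (hΓ.mem h1 (by simp)) (ih (hΓ.cons _))
  | orL h1 _ _ ih ih' => exact .orL (hΓ.mem h1 (by simp)) (ih (hΓ.cons _)) (ih' (hΓ.cons _))
  | boxL h1 h2 _ ih =>
    obtain ⟨r, h3, h4⟩ := hΓ.exists_box h.refl h1
    exact .boxL h3 (h.upward _ _ h4 h2) (ih (hΓ.cons _))

/-- A closed set and an open set intersect compatibly with the closure. -/
theorem leftClosure_inter {X Y : List (Formula 𝕄 𝕋) → Prop}
    (hX : ∀ Γ Γ', Covers Ax Γ' Γ → X Γ → X Γ') {Γ : List (Formula 𝕄 𝕋)}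
    (hΓ : X Γ) (hA : LeftClosure Ax sub E Y Γ) :
    LeftClosure Ax sub E (fun Γ => X Γ ∧ Y Γ) Γ := by
  induction hA with
  | base h => exact .base ⟨hΓ, h⟩
  | impL h1 h2 _ ih => exact .impL h1 h2 (ih (hX _ _ (covers_cons _ _) hΓ))
  | botL h1 => exact .botL h1
  | andL1 h1 _ ih => exact .andL1 h1 (ih (hX _ _ (covers_cons _ _) hΓ))
  | andL2 h1 _ ih => exact .andL2 h1 (ih (hX _ _ (covers_cons _ _) hΓ))
  | orL h1 _ _ ih ih' =>
    exact .orL h1 (ih (hX _ _ (covers_cons _ _) hΓ)) (ih' (hX _ _ (covers_cons _ _) hΓ))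
  | boxL h1 h2 _ ih => exact .boxL h1 h2 (ih (hX _ _ (covers_cons _ _) hΓ))

theorem isStable_leftClosure (h : IsUnfoldingCalculus Ax sub E) {X : List (Formula 𝕄 𝕋) → Prop}
    (hX : ∀ Γ Γ', Covers Ax Γ' Γ → X Γ → X Γ') : IsStable Ax sub E (LeftClosure Ax sub E X) where
  mono _ _ hΓ hA := h.leftClosure_mono hX hΓ hA
  closed _ hA := hA.bind fun _ h => h

/-- Left closure consists of left inferences with the succedent left open; fixing `A` turns each
into an actual rule. -/
theorem isStable_provable (h : IsUnfoldingCalculus Ax sub E) (A : Formula 𝕄 𝕋) :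
    IsStable Ax sub E fun Γ => Provable (Rule Ax sub E) (Γ, A) where
  mono _ _ hΓ hA := h.provable_mono hΓ hA
  closed Γ hA := by
    induction hA with
    | base h => exact h
    | impL h1 h2 _ ih => exact .step _ (.impL h1) (List.forall_mem_pair.2 ⟨h2, ih⟩)
    | botL h1 => exact .step _ (.botL h1) (by simp)
    | andL1 h1 _ ih => exact .step _ (.andL1 h1) (List.forall_mem_singleton.2 ih)
    | andL2 h1 _ ih => exact .step _ (.andL2 h1) (List.forall_mem_singleton.2 ih)
    | orL h1 _ _ ih ih' => exact .step _ (.orL h1) (List.forall_mem_pair.2 ⟨ih, ih'⟩)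
    | boxL h1 h2 _ ih => exact .step _ (.boxL h1 h2) (List.forall_mem_singleton.2 ih)

end IsUnfoldingCalculus

/-- The interpretation of formulas by sets of contexts. -/
def Sem (Ax : Set (𝕄 × List 𝕄)) (sub : 𝕄 → 𝕄 → Option 𝕄) (E : Set 𝕄) :
    Formula 𝕄 𝕋 → List (Formula 𝕄 𝕋) → Prop
  | .top => fun _ => True
  | .bot => LeftClosure Ax sub E fun _ => False
  | .tok t => fun Γ => Provable (Rule Ax sub E) (Γ, .tok t)
  | .box m A => LeftClosure Ax sub E fun Γ => Sem Ax sub E A (shiftContext Ax sub m Γ)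
  | .imp A B => fun Γ => ∀ Γ', Covers Ax Γ' Γ → Sem Ax sub E A Γ' → Sem Ax sub E B Γ'
  | .and A B => fun Γ => Sem Ax sub E A Γ ∧ Sem Ax sub E B Γ
  | .or A B => LeftClosure Ax sub E fun Γ => Sem Ax sub E A Γ ∨ Sem Ax sub E B Γ

namespace IsUnfoldingCalculus

/-- Falsity, modalities and disjunctions are closed off by definition. The other connectives inherit
stability from provability or from their components. -/
theorem isStable_sem (h : IsUnfoldingCalculus Ax sub E) (A : Formula 𝕄 𝕋) :
    IsStable Ax sub E (Sem Ax sub E A) := by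
  induction A with
  | top => exact ⟨fun _ _ _ _ => trivial, fun _ _ => trivial⟩
  | bot => exact h.isStable_leftClosure fun _ _ _ h => h
  | tok t => exact h.isStable_provable _
  | box m A ih =>
    exact h.isStable_leftClosure fun _ _ hΓ hA =>
      ih.mono _ _ (hΓ.shiftContext h.refl h.trans h.sub (h.refl m)) hA
  | imp A B ihA ihB =>
    have mono : ∀ Γ Γ', Covers Ax Γ' Γ → Sem Ax sub E (.imp A B) Γ →
        Sem Ax sub E (.imp A B) Γ' := fun Γ Γ' hΓ hA Δ hΔ => hA Δ (hΔ.trans h.trans hΓ)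
    refine ⟨mono, fun Γ hA Δ hΔ hΔA => ihB.closed _ ?_⟩
    -- Passing to the larger context `Δ`, membership in the denotation of `A` persists to every
    -- leaf, where the implication can be applied.
    refine (leftClosure_inter ihA.mono hΔA (h.leftClosure_mono mono hΔ hA)).bind ?_
    exact fun Θ hΘ => .base (hΘ.2 _ (.refl _) hΘ.1)
  | and A B ihA ihB =>
    exact ⟨fun _ _ hΓ hA => ⟨ihA.mono _ _ hΓ hA.1, ihB.mono _ _ hΓ hA.2⟩,
      fun _ hA => ⟨ihA.closed _ (hA.bind fun _ h => .base h.1),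
        ihB.closed _ (hA.bind fun _ h => .base h.2)⟩⟩
  | or A B ihA ihB =>
    exact h.isStable_leftClosure fun _ _ hΓ hA =>
      hA.imp (ihA.mono _ _ hΓ) (ihB.mono _ _ hΓ)

/-- Every context that contains a formula belongs to its interpretation, and proves every formula
to whose interpretation it belongs. -/
theorem sem_of_mem_and_provable_of_sem (h : IsUnfoldingCalculus Ax sub E) (A : Formula 𝕄 𝕋) :
    (∀ Γ, A ∈ Γ → Sem Ax sub E A Γ) ∧
      ∀ Γ, Sem Ax sub E A Γ → Provable (Rule Ax sub E) (Γ, A) := by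
  induction A with
  | top => exact ⟨fun _ _ => trivial, fun _ _ => .step _ .topR (by simp)⟩
  | bot =>
    exact ⟨fun _ h => .botL h, fun _ hA =>
      (h.isStable_provable _).closed _ (hA.bind fun _ h => h.elim)⟩
  | tok t => exact ⟨fun _ h => .step _ (.var h) (by simp), fun _ h => h⟩
  | box m A ih =>
    -- Reflexivity `m ⇛ m` puts the body `A` into the context shifted by `m`.
    refine ⟨fun Γ hΓ => .base (ih.1 _ (mem_shiftContext.2 ⟨m, A, hΓ, .inl ⟨h.refl m, rfl⟩⟩)),
      fun Γ hA => (h.isStable_provable _).closed _ (hA.bind fun Δ hΔ => .base ?_)⟩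
    exact .step _ .modR (List.forall_mem_singleton.2 (ih.2 _ hΔ))
  | imp A B ihA ihB =>
    refine ⟨fun Γ hΓ Δ hΔ hA => ?_, fun Γ hΓ => ?_⟩
    · exact (h.isStable_sem B).closed _ (.impL (hΔ.mem hΓ (by simp)) (ihA.2 _ hA)
        (.base (ihB.1 _ List.mem_cons_self)))
    · exact .step _ .impR (List.forall_mem_singleton.2
        (ihB.2 _ (hΓ _ (covers_cons _ _) (ihA.1 _ List.mem_cons_self))))
  | and A B ihA ihB =>
    refine ⟨fun Γ hΓ => ⟨?_, ?_⟩, fun Γ hΓ =>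
      .step _ .andR (List.forall_mem_pair.2 ⟨ihA.2 _ hΓ.1, ihB.2 _ hΓ.2⟩)⟩
    · exact (h.isStable_sem A).closed _ (.andL1 hΓ (.base (ihA.1 _ List.mem_cons_self)))
    · exact (h.isStable_sem B).closed _ (.andL2 hΓ (.base (ihB.1 _ List.mem_cons_self)))
  | or A B ihA ihB =>
    refine ⟨fun Γ hΓ => .orL hΓ (.base (.inl (ihA.1 _ List.mem_cons_self)))
      (.base (.inr (ihB.1 _ List.mem_cons_self))), fun Γ hΓ =>
      (h.isStable_provable _).closed _ (hΓ.bind fun Δ hΔ => .base ?_)⟩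
    rcases hΔ with hΔ | hΔ
    · exact .step _ .orR1 (List.forall_mem_singleton.2 (ihA.2 _ hΔ))
    · exact .step _ .orR2 (List.forall_mem_singleton.2 (ihB.2 _ hΔ))

/-- If every formula of `Δ` is obtained from `Γ` by removing a modality in `E`, then a stable
set that contains `Δ ++ Γ` contains `Γ`. -/
theorem leftClosure_of_append {X : List (Formula 𝕄 𝕋) → Prop} {Γ Δ : List (Formula 𝕄 𝕋)}
    (hΔ : ∀ B ∈ Δ, ∃ m ∈ E, .box m B ∈ Γ) (hX : X (Δ ++ Γ)) : LeftClosure Ax sub E X Γ := by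
  suffices ∀ Δ', (∀ B ∈ Δ', ∃ m ∈ E, .box m B ∈ Γ) → LeftClosure Ax sub E X (Δ' ++ Γ) →
    LeftClosure Ax sub E X Γ from this Δ hΔ (.base hX)
  intro Δ'
  induction Δ' with
  | nil => exact fun _ h => h
  | cons B Δ' ih =>
    intro hB h
    obtain ⟨m, hm, hmB⟩ := hB B List.mem_cons_self
    exact ih (fun C hC => hB C (List.mem_cons_of_mem _ hC))
      (.boxL (List.mem_append_right _ hmB) hm h)

/-- With `m ⇛ ε`, the shifted context is covered by `Γ` enlarged with the bodies that `E` allows to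
strip: `k ⇛ m` gives `k ⇛ ε`, and `k ⇛ m·q` gives `k ⇛ q`. This is where the extra left rule is
needed. -/
theorem sem_of_sem_shiftContext (h : IsUnfoldingCalculus Ax sub E) {A : Formula 𝕄 𝕋} {m : 𝕄}
    (hm : (m, []) ∈ Ax) {Γ : List (Formula 𝕄 𝕋)}
    (hA : Sem Ax sub E A (shiftContext Ax sub m Γ)) : Sem Ax sub E A Γ := by
  classical
  let Δ : List (Formula 𝕄 𝕋) := Γ.flatMap fun F => match F with
    | .box k B => if k ∈ E then [B] else []
    | _ => []
  have hΔ : ∀ B, B ∈ Δ ↔ ∃ k ∈ E, .box k B ∈ Γ := by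
    intro B
    simp only [Δ, List.mem_flatMap]
    constructor
    · rintro ⟨F, hF, hB⟩
      cases F <;> simp only [List.not_mem_nil, List.mem_ite_nil_right, List.mem_singleton] at hB
      obtain ⟨h1, rfl⟩ := hB
      exact ⟨_, h1, hF⟩
    · rintro ⟨k, hk, hB⟩
      exact ⟨_, hB, by simp [hk]⟩
  refine (h.isStable_sem A).closed _ (leftClosure_of_append (fun B hB => (hΔ B).1 hB)
    ((h.isStable_sem A).mono _ _ ?_ hA))
  intro F hF
  obtain ⟨k, B, hB, ⟨hk, rfl⟩ | ⟨q, hq, rfl⟩⟩ := mem_shiftContext.1 hF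
  · exact .inl (List.mem_append_left _
      ((hΔ _).2 ⟨k, h.upward k m hk ((h.mem_iff m).2 hm), hB⟩))
  · have := h.trans k m [] [q] [] (h.sub.mem hq) hm
    exact .inr ⟨k, q, B, rfl, List.mem_append_right _ hB, by simpa using this⟩

/-- Peel `l` from the left. After its first modality `n`, what remains is an unfolding of the
remainder `m ⊖ n`, so the induction varies `m`; a list of length at most one has no remainder and is
treated directly. -/
theorem sem_boxes (h : IsUnfoldingCalculus Ax sub E) {A : Formula 𝕄 𝕋} (l : List 𝕄) :
    ∀ {m : 𝕄}, (m, l) ∈ Ax → ∀ {Γ : List (Formula 𝕄 𝕋)}, Sem Ax sub E (.box m A) Γ →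
      Sem Ax sub E (A.boxes l) Γ := by
  induction l with
  | nil =>
    intro m hm Γ hΓ
    exact (h.isStable_sem A).closed _ (hΓ.bind fun Δ hΔ => .base (h.sem_of_sem_shiftContext hm hΔ))
  | cons n l ih =>
    intro m hm Γ hΓ
    refine hΓ.bind fun Δ hΔ => .base ?_
    cases l with
    | nil =>
      exact (h.isStable_sem A).mono _ _
        ((Covers.refl Δ).shiftContext h.refl h.trans h.sub hm) hΔ
    | cons t l =>
      obtain ⟨r, hr, hr'⟩ := h.sub.exists_remainder hm
      refine ih hr' (.base ?_)
      exact (h.isStable_sem A).mono _ _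
        (covers_shiftContext_shiftContext h.trans h.sub Δ (h.sub.mem hr)) hΔ

/-- Soundness of natural deduction. Eliminations, and with them cut, become function application or
continuation of a left closure inside the model. -/
theorem sem_of_derivable (h : IsUnfoldingCalculus Ax sub E) {S : Set (Formula 𝕄 𝕋)}
    {A : Formula 𝕄 𝕋} (hA : Derivable Ax S A) :
    ∀ Γ, (∀ B ∈ S, Sem Ax sub E B Γ) → Sem Ax sub E A Γ := by
  have ins : ∀ {S : Set (Formula 𝕄 𝕋)} {C : Formula 𝕄 𝕋} {Γ Γ' : List (Formula 𝕄 𝕋)},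
      Covers Ax Γ' Γ → (∀ B ∈ S, Sem Ax sub E B Γ) → Sem Ax sub E C Γ' →
      ∀ B ∈ insert C S, Sem Ax sub E B Γ' := by
    rintro S C Γ Γ' hΓ hS hC B (rfl | hB)
    · exact hC
    · exact (h.isStable_sem B).mono _ _ hΓ (hS B hB)
  induction hA with
  | ax hA => exact fun Γ hΓ => hΓ _ hA
  | topI => exact fun _ _ => trivial
  | botE _ ih =>
    exact fun Γ hΓ => (h.isStable_sem _).closed _ ((ih Γ hΓ).bind fun _ h => h.elim)
  | impE _ _ ih ih' => exact fun Γ hΓ => ih' Γ hΓ Γ (.refl _) (ih Γ hΓ)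
  | impI _ ih => exact fun Γ hΓ Δ hΔ hA => ih Δ (ins hΔ hΓ hA)
  | andE1 _ ih => exact fun Γ hΓ => (ih Γ hΓ).1
  | andE2 _ ih => exact fun Γ hΓ => (ih Γ hΓ).2
  | andI _ _ ih ih' => exact fun Γ hΓ => ⟨ih Γ hΓ, ih' Γ hΓ⟩
  | orI1 _ ih => exact fun Γ hΓ => .base (.inl (ih Γ hΓ))
  | orI2 _ ih => exact fun Γ hΓ => .base (.inr (ih Γ hΓ))
  | @orE S A B C _ _ _ ih ihA ihB =>
    intro Γ hΓ
    -- The assumptions `S` are carried to every leaf of the closure, since both branches need them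
    -- next to the chosen disjunct.
    refine (h.isStable_sem C).closed _ ((leftClosure_inter
      (X := fun Δ => ∀ D ∈ S, Sem Ax sub E D Δ) ?_ hΓ (ih Γ hΓ)).bind fun Δ hΔ => .base ?_)
    · exact fun Δ Δ' hΔ hS D hD => (h.isStable_sem D).mono _ _ hΔ (hS D hD)
    · rcases hΔ with ⟨hS, hA | hB⟩
      · exact ihA Δ (ins (.refl _) hS hA)
      · exact ihB Δ (ins (.refl _) hS hB)
  | @modal S m B As _ _ ih ih' =>
    intro Γ hΓ
    have mono : ∀ (L : List (Formula 𝕄 𝕋)) (Δ Δ' : List (Formula 𝕄 𝕋)), Covers Ax Δ' Δ →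
        (∀ A ∈ L, Sem Ax sub E A (shiftContext Ax sub m Δ)) →
        ∀ A ∈ L, Sem Ax sub E A (shiftContext Ax sub m Δ') := fun L Δ Δ' hΔ hL A hA =>
      (h.isStable_sem A).mono _ _ (hΔ.shiftContext h.refl h.trans h.sub (h.refl m)) (hL A hA)
    -- Finitely many separate left closures are merged into one whose leaves satisfy all premises
    -- simultaneously.
    have key : ∀ L : List (Formula 𝕄 𝕋), (∀ A ∈ L, Sem Ax sub E (.box m A) Γ) →
        LeftClosure Ax sub E (fun Δ => ∀ A ∈ L, Sem Ax sub E A (shiftContext Ax sub m Δ)) Γ := by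
      intro L
      induction L with
      | nil => exact fun _ => .base (by simp)
      | cons A L ihL =>
        intro hL
        have h1 := ihL fun B hB => hL B (List.mem_cons_of_mem _ hB)
        have h2 := leftClosure_inter (fun _ _ hΓ hA => (h.isStable_sem (.box m A)).mono _ _ hΓ hA)
          (hL A List.mem_cons_self) h1
        refine h2.bind fun Δ hΔ => ?_
        refine (leftClosure_inter (mono L) hΔ.2 hΔ.1).bind fun Θ hΘ => .base ?_
        exact List.forall_mem_cons.2 ⟨hΘ.2, hΘ.1⟩
    exact (key As fun A hA => ih A hA Γ hΓ).bind fun Δ hΔ => .base (ih' _ hΔ)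
  | unfold _ hm ih => exact fun Γ hΓ => h.sem_boxes _ hm (ih Γ hΓ)

/-- Evaluate soundness at `Γ` itself, which lies in the denotation of each of its members. -/
theorem provable_of_derivable (h : IsUnfoldingCalculus Ax sub E) {Γ : List (Formula 𝕄 𝕋)}
    {A : Formula 𝕄 𝕋} (hA : Derivable Ax {B | B ∈ Γ} A) : Provable (Rule Ax sub E) (Γ, A) :=
  (h.sem_of_mem_and_provable_of_sem A).2 _
    (h.sem_of_derivable hA Γ fun B hB => (h.sem_of_mem_and_provable_of_sem B).1 _ hB)

theorem derivable_of_provable (h : IsUnfoldingCalculus Ax sub E) {s : Sequent 𝕄 𝕋}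
    (hs : Provable (Rule Ax sub E) s) : Derivable Ax {B | B ∈ s.1} s.2 := by
  have cons : ∀ (A : Formula 𝕄 𝕋) (Γ : List (Formula 𝕄 𝕋)),
      {B | B ∈ A :: Γ} = insert A {B | B ∈ Γ} := fun A Γ => by
    ext
    simp
  have cut : ∀ {A C : Formula 𝕄 𝕋} {Γ : List (Formula 𝕄 𝕋)}, Derivable Ax {B | B ∈ Γ} A →
      Derivable Ax {B | B ∈ A :: Γ} C → Derivable Ax {B | B ∈ Γ} C := fun {A C Γ} hA hC => by
    rw [cons] at hC
    exact .impE hA (.impI hC)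
  induction hs with
  | @step q i hi _ ih =>
    cases hi with
    | var h => exact .ax h
    | impR =>
      have := List.forall_mem_singleton.1 ih
      rw [cons] at this
      exact .impI this
    | impL h =>
      exact cut (.impE (List.forall_mem_pair.1 ih).1 (.ax h)) (List.forall_mem_pair.1 ih).2
    | @modR Γ m A =>
      -- The modal rule is applied to the whole shifted context: `m F` follows from `k B` by `k ⇛ m`
      -- or by `k ⇛ m·q`.
      refine .modal _ (fun F hF => ?_) (ih (_, _) (List.mem_singleton_self _))
      obtain ⟨k, B, hB, ⟨hk, rfl⟩ | ⟨q, hq, rfl⟩⟩ := mem_shiftContext.1 hF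
      · exact .unfold (.ax hB) hk
      · exact .unfold (.ax hB) (h.sub.mem hq)
    | topR => exact .topI
    | botL h => exact .botE (.ax h)
    | andL1 h => exact cut (.andE1 (.ax h)) (ih (_, _) (List.mem_singleton_self _))
    | andL2 h => exact cut (.andE2 (.ax h)) (ih (_, _) (List.mem_singleton_self _))
    | andR => exact .andI (List.forall_mem_pair.1 ih).1 (List.forall_mem_pair.1 ih).2
    | orL h =>
      have hA := (List.forall_mem_pair.1 ih).1
      have hB := (List.forall_mem_pair.1 ih).2
      rw [cons] at hA hB
      exact .orE (.ax h) hA hB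
    | orR1 => exact .orI1 (ih (_, _) (List.mem_singleton_self _))
    | orR2 => exact .orI2 (ih (_, _) (List.mem_singleton_self _))
    | boxL hA hm =>
      exact cut (.unfold (.ax hA) ((h.mem_iff _).1 hm)) (ih (_, _) (List.mem_singleton_self _))

end IsUnfoldingCalculus

theorem AxDecomposable.exists_isSubtraction (hd : AxDecomposable Ax) :
    ∃ sub, IsSubtraction Ax sub := by
  classical
  refine ⟨fun m n => if h : ∃ r, IsRemainder Ax m n r then some h.choose else none, ?_, ?_⟩
  · intro m n r h
    dsimp only at h
    split_ifs at h with h'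
    obtain rfl := Option.some.inj h
    exact h'.choose_spec
  · intro m n n' l h
    exact ⟨_, dif_pos (hd m n n' l h)⟩

theorem computablePred_derivable [Finite 𝕄] [Primcodable 𝕄] [Primcodable 𝕋]
    (hr : AxReflexive Ax) (ht : AxTransitive Ax) (hd : AxDecomposable Ax) :
    ComputablePred fun s : List (Formula 𝕄 𝕋) × Formula 𝕄 𝕋 =>
      Derivable Ax {B | B ∈ s.1} s.2 := by
  obtain ⟨sub, hs⟩ := hd.exists_isSubtraction
  have h : IsUnfoldingCalculus Ax sub {m | (m, []) ∈ Ax} := ⟨hr, ht, hs, fun _ => Iff.rfl⟩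
  exact (computablePred_provable_rule hr ht hs h.upward).of_eq fun s =>
    ⟨h.derivable_of_provable, h.provable_of_derivable⟩

end

/-! ### The Fitch-style calculus and its translation to closed formulas -/

section

variable {𝕄 : Type u} {𝕋 : Type v} {Ax : Set (𝕄 × List 𝕄)}

theorem Derivable.mono {S : Set (Formula 𝕄 𝕋)} {A : Formula 𝕄 𝕋} (h : Derivable Ax S A) :
    ∀ {T}, S ⊆ T → Derivable Ax T A := by
  induction h with
  | ax h => exact fun hT => .ax (hT h)
  | topI => exact fun _ => .topI
  | botE _ ih => exact fun hT => .botE (ih hT)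
  | impE _ _ ih ih' => exact fun hT => .impE (ih hT) (ih' hT)
  | impI _ ih => exact fun hT => .impI (ih (Set.insert_subset_insert hT))
  | andE1 _ ih => exact fun hT => .andE1 (ih hT)
  | andE2 _ ih => exact fun hT => .andE2 (ih hT)
  | andI _ _ ih ih' => exact fun hT => .andI (ih hT) (ih' hT)
  | orI1 _ ih => exact fun hT => .orI1 (ih hT)
  | orI2 _ ih => exact fun hT => .orI2 (ih hT)
  | orE _ _ _ ih ihA ihB =>
    exact fun hT => .orE (ih hT) (ihA (Set.insert_subset_insert hT))
      (ihB (Set.insert_subset_insert hT))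
  | modal As _ h ih _ => exact fun hT => .modal As (fun A hA => ih A hA hT) h
  | unfold _ hm ih => exact fun hT => .unfold (ih hT) hm

/-- Discharge the list by implication introductions and eliminate them again, so no separate
substitution argument is needed. -/
theorem Derivable.cut_list {S : Set (Formula 𝕄 𝕋)} (L : List (Formula 𝕄 𝕋)) {B : Formula 𝕄 𝕋}
    (hL : ∀ A ∈ L, Derivable Ax S A) (h : Derivable Ax {A | A ∈ L} B) : Derivable Ax S B := by
  induction L generalizing B with
  | nil => exact h.mono (by simp)
  | cons A L ih =>
    refine .impE (hL A List.mem_cons_self)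
      (ih (fun C hC => hL C (List.mem_cons_of_mem _ hC)) (.impI (h.mono ?_)))
    intro C hC
    exact List.mem_cons.1 hC

theorem Derivable.boxes_mono {A B : Formula 𝕄 𝕋} (h : Derivable Ax {A} B) (l : List 𝕄) :
    ∀ {S : Set (Formula 𝕄 𝕋)}, Derivable Ax S (A.boxes l) → Derivable Ax S (B.boxes l) := by
  induction l with
  | nil => exact fun hS => .cut_list [A] (List.forall_mem_singleton.2 hS) (h.mono (by simp))
  | cons n l ih =>
    intro S hS
    exact .modal [A.boxes l] (List.forall_mem_singleton.2 hS) (ih (.ax (by simp)))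

theorem Formula.boxes_append (l l' : List 𝕄) (A : Formula 𝕄 𝕋) :
    A.boxes (l ++ l') = (A.boxes l').boxes l := List.foldr_append

/-- The formula that expresses in the empty context that `A` holds in the context `Γ`. -/
def Context.close : Context 𝕄 𝕋 → Formula 𝕄 𝕋 → Formula 𝕄 𝕋
  | [], A => A
  | .hyp _ B :: Γ, A => Context.close Γ (.imp B A)
  | .lock m :: Γ, A => Context.close Γ (.box m A)

theorem Context.close_append (Δ Γ : Context 𝕄 𝕋) (A : Formula 𝕄 𝕋) :
    Context.close (Δ ++ Γ) A = Context.close Γ (Context.close Δ A) := by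
  induction Δ generalizing A with
  | nil => rfl
  | cons e Δ ih => cases e <;> exact ih _

theorem Context.locks_append (Δ Γ : Context 𝕄 𝕋) :
    Context.locks (Δ ++ Γ) = Context.locks Γ ++ Context.locks Δ := by
  induction Δ with
  | nil => simp [Context.locks]
  | cons e Δ ih => cases e <;> simp [Context.locks, ih]

/-- Discharging a context acts like a normal modality: both `C ⇒ _` and `m _` respect entailment
from finitely many premises. It lets every local typing rule be checked without its context. -/
theorem derivable_close (Γ : Context 𝕄 𝕋) (L : List (Formula 𝕄 𝕋)) {B : Formula 𝕄 𝕋}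
    (hL : ∀ A ∈ L, Derivable Ax ∅ (Γ.close A)) (h : Derivable Ax {A | A ∈ L} B) :
    Derivable Ax ∅ (Γ.close B) := by
  induction Γ generalizing L B with
  | nil => exact .cut_list L hL h
  | cons e Γ ih =>
    cases e with
    | hyp x C =>
      refine ih (L.map (.imp C)) (by simpa [Context.close] using hL)
        (.impI (.cut_list L (fun A hA => .impE (.ax (Set.mem_insert _ _)) (.ax (.inr ?_))) h))
      exact List.mem_map_of_mem hA
    | lock m =>
      refine ih (L.map (.box m)) (by simpa [Context.close] using hL)
        (.modal L (fun A hA => .ax ?_) h)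
      exact List.mem_map_of_mem hA

/-- The hypotheses of `Δ` are inserted as vacuous implications under the modalities. The variable
and key rules rely on this to skip over `Δ`. -/
theorem Derivable.close {Δ : Context 𝕄 𝕋} {S : Set (Formula 𝕄 𝕋)} {A : Formula 𝕄 𝕋}
    (h : Derivable Ax S (A.boxes Δ.locks)) : Derivable Ax S (Δ.close A) := by
  induction Δ generalizing A with
  | nil => exact h
  | cons e Δ ih =>
    cases e with
    | hyp x B => exact ih (.boxes_mono (.impI (.ax (by simp))) _ h)
    | lock m =>
      rw [Context.locks, Formula.boxes_append] at h
      exact ih h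

theorem derivable_of_hasType {Γ : Context 𝕄 𝕋} {P : LTerm 𝕄 𝕋} {A : Formula 𝕄 𝕋}
    (h : HasType Ax Γ P A) : Derivable Ax ∅ (Γ.close A) := by
  have one : ∀ {Γ : Context 𝕄 𝕋} {A B : Formula 𝕄 𝕋}, Derivable Ax ∅ (Γ.close A) →
      Derivable Ax {A} B → Derivable Ax ∅ (Γ.close B) := fun {Γ A B} hA hB =>
    derivable_close Γ [A] (by simpa using hA) (hB.mono (by simp))
  have two : ∀ {Γ : Context 𝕄 𝕋} {A B C : Formula 𝕄 𝕋}, Derivable Ax ∅ (Γ.close A) →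
      Derivable Ax ∅ (Γ.close B) → Derivable Ax {A, B} C → Derivable Ax ∅ (Γ.close C) :=
    fun {Γ A B C} hA hB hC =>
      derivable_close Γ [A, B] (by simpa using ⟨hA, hB⟩) (hC.mono (by simp [Set.insert_subset_iff]))
  induction h with
  | @var Γ Δ x A hΔ =>
    rw [Context.close_append]
    refine derivable_close Γ [] (by simp) (.impI (.close ?_))
    rw [hΔ]
    exact .ax (Set.mem_insert _ _)
  | star => exact derivable_close _ [] (by simp) .topI
  | abs _ ih => exact one ih (.botE (.ax rfl))
  | lock _ ih => exact ih
  | @key Γ Δ P m l A _ hm hl ih =>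
    rw [Context.close_append]
    refine one ih (.close ?_)
    rw [hl]
    exact .unfold (.ax rfl) hm
  | @app Γ P Q A B _ _ ih ih' =>
    exact two ih ih' (.impE (A := A) (.ax (by simp)) (.ax (by simp)))
  | lam _ ih => exact ih
  | fst _ ih => exact one ih (.andE1 (.ax rfl))
  | snd _ ih => exact one ih (.andE2 (.ax rfl))
  | pair _ _ ih ih' => exact two ih ih' (.andI (.ax (by simp)) (.ax (by simp)))
  | @case Γ P Q R x y A B C _ _ _ ihP ihQ ihR =>
    refine derivable_close Γ [.imp A C, .imp B C, .or A B] ?_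
      (.orE (A := A) (B := B) (.ax (by simp)) (.impE (A := A) (.ax (by simp)) (.ax (by simp)))
        (.impE (A := B) (.ax (by simp)) (.ax (by simp))))
    simpa using ⟨ihP, ihQ, ihR⟩
  | inl _ ih => exact one ih (.orI1 (.ax rfl))
  | inr _ ih => exact one ih (.orI2 (.ax rfl))

theorem Context.sublist_locks {Γ Γ' : Context 𝕄 𝕋} (h : Γ.Sublist Γ') :
    Γ.locks.Sublist Γ'.locks := by
  induction h with
  | slnil => exact .slnil
  | cons e _ ih =>
    cases e with
    | hyp x B => exact ih
    | lock m => exact ih.trans (List.sublist_append_left _ _)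
  | cons_cons e _ ih =>
    cases e with
    | hyp x B => exact ih
    | lock m => exact ih.append_right _

/-- Each part can only gain locks while their total is unchanged, so by counting neither part gains
any. -/
theorem Context.exists_of_append_sublist {Δ Γ Γ' : Context 𝕄 𝕋} (h : (Δ ++ Γ).Sublist Γ')
    (hl : Γ'.locks = Context.locks (Δ ++ Γ)) : ∃ Δ' Γ'', Γ' = Δ' ++ Γ'' ∧ Γ.Sublist Γ'' ∧
      Δ'.locks = Δ.locks ∧ Γ''.locks = Γ.locks := by
  obtain ⟨Δ', Γ'', rfl, h1, h2⟩ := List.append_sublist_iff.1 h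
  rw [Context.locks_append, Context.locks_append] at hl
  have e := congrArg List.length hl
  simp only [List.length_append] at e
  have l1 := (Context.sublist_locks h1).length_le
  have l2 := (Context.sublist_locks h2).length_le
  exact ⟨Δ', Γ'', rfl, h2, ((Context.sublist_locks h1).eq_of_length (by omega)).symm,
    ((Context.sublist_locks h2).eq_of_length (by omega)).symm⟩

/-- Only hypotheses may be inserted, since new locks would break the variable and key rules. The
term stays the same because the variable rule permits any matching entry, so shadowing is harmless.
-/
theorem HasType.weaken {Γ : Context 𝕄 𝕋} {P : LTerm 𝕄 𝕋} {A : Formula 𝕄 𝕋}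
    (h : HasType Ax Γ P A) :
    ∀ Γ' : Context 𝕄 𝕋, Γ.Sublist Γ' → Γ'.locks = Γ.locks → HasType Ax Γ' P A := by
  induction h with
  | @var Γ Δ x A hΔ =>
    intro Γ' h hl
    obtain ⟨Δ', Γ'', rfl, h1, h2, h3⟩ := Context.exists_of_append_sublist h hl
    obtain ⟨Θ, Γ₃, rfl, h4, h5⟩ := List.cons_sublist_iff.1 h1
    obtain ⟨Θ₁, Θ₂, rfl⟩ := List.append_of_mem h4
    -- The locks in front of the retained variable are superfluous, because the embedded tail
    -- already accounts for all of them.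
    have hl3 : Context.locks Θ₁ = [] := by
      have l1 := (Context.sublist_locks h5).length_le
      have := congrArg List.length h3
      simp only [Context.locks_append, Context.locks, List.length_append] at this
      exact List.length_eq_zero_iff.1 (by omega)
    have e : Δ' ++ (Θ₁ ++ .hyp x A :: Θ₂ ++ Γ₃) = (Δ' ++ Θ₁) ++ .hyp x A :: (Θ₂ ++ Γ₃) := by simp
    rw [e]
    exact .var (by rw [Context.locks_append, hl3, h2, hΔ]; rfl)
  | star => exact fun _ _ _ => .star
  | abs _ ih => exact fun Γ' h hl => .abs (ih Γ' h hl)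
  | @lock Γ P m A _ ih =>
    exact fun Γ' h hl => .lock (ih (.lock m :: Γ') (h.cons_cons _) (by simp [Context.locks, hl]))
  | @key Γ Δ P m l A _ hm hΔ ih =>
    intro Γ' h hl
    obtain ⟨Δ', Γ'', rfl, h1, h2, h3⟩ := Context.exists_of_append_sublist h hl
    exact .key (ih Γ'' h1 h3) hm (h2.trans hΔ)
  | app _ _ ih ih' => exact fun Γ' h hl => .app (ih Γ' h hl) (ih' Γ' h hl)
  | lam _ ih => exact fun Γ' h hl => .lam (ih (_ :: Γ') (h.cons_cons _) hl)
  | fst _ ih => exact fun Γ' h hl => .fst (ih Γ' h hl)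
  | snd _ ih => exact fun Γ' h hl => .snd (ih Γ' h hl)
  | pair _ _ ih ih' => exact fun Γ' h hl => .pair (ih Γ' h hl) (ih' Γ' h hl)
  | case _ _ _ ihP ihQ ihR =>
    exact fun Γ' h hl => .case (ihP (_ :: Γ') (h.cons_cons _) hl)
      (ihQ (_ :: Γ') (h.cons_cons _) hl) (ihR Γ' h hl)
  | inl _ ih => exact fun Γ' h hl => .inl (ih Γ' h hl)
  | inr _ ih => exact fun Γ' h hl => .inr (ih Γ' h hl)

theorem HasType.weaken_hyp {Γ : Context 𝕄 𝕋} {P : LTerm 𝕄 𝕋} {A : Formula 𝕄 𝕋}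
    (h : HasType Ax Γ P A) (x : ℕ) (B : Formula 𝕄 𝕋) : HasType Ax (.hyp x B :: Γ) P A :=
  h.weaken _ (List.sublist_cons_self _ _) rfl

theorem hasType_var_head (Γ : Context 𝕄 𝕋) (x : ℕ) (A : Formula 𝕄 𝕋) :
    HasType Ax (.hyp x A :: Γ) (.var x) A := .var (Δ := []) rfl

theorem HasType.unlock (hr : AxReflexive Ax) {Γ : Context 𝕄 𝕋} {P : LTerm 𝕄 𝕋} {m : 𝕄}
    {A : Formula 𝕄 𝕋} (h : HasType Ax Γ P (.box m A)) :
    HasType Ax (.lock m :: Γ) (.key m [m] P) A := .key (Δ := [.lock m]) h (hr m) rfl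

theorem HasType.exists_boxes (l : List 𝕄) : ∀ {Γ : Context 𝕄 𝕋} {P : LTerm 𝕄 𝕋}
    {A : Formula 𝕄 𝕋}, HasType Ax ((l.reverse.map .lock) ++ Γ) P A →
      ∃ Q, HasType Ax Γ Q (A.boxes l) := by
  induction l with
  | nil => exact fun h => ⟨_, h⟩
  | cons n l ih =>
    intro Γ P A h
    obtain ⟨Q, hQ⟩ := ih (Γ := .lock n :: Γ) (P := P) (A := A) (by simpa using h)
    exact ⟨_, .lock hQ⟩

theorem Context.locks_map_lock (l : List 𝕄) :
    Context.locks (l.reverse.map .lock : Context 𝕄 𝕋) = l := by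
  induction l with
  | nil => rfl
  | cons n l ih =>
    rw [List.reverse_cons, List.map_append, Context.locks_append, ih]
    rfl

/-- Assumptions are replaced by inhabitants in an arbitrary context rather than by variables, so
that the modal rule can pass beneath a lock and supply `key` terms there. Name `0` can be reused for
every binder. -/
theorem Derivable.exists_hasType (hr : AxReflexive Ax) {S : Set (Formula 𝕄 𝕋)}
    {A : Formula 𝕄 𝕋} (h : Derivable Ax S A) : ∀ Γ : Context 𝕄 𝕋,
      (∀ B ∈ S, ∃ P, HasType Ax Γ P B) → ∃ P, HasType Ax Γ P A := by
  have ins : ∀ {S : Set (Formula 𝕄 𝕋)} {Γ : Context 𝕄 𝕋} (C : Formula 𝕄 𝕋),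
      (∀ B ∈ S, ∃ P, HasType Ax Γ P B) →
      ∀ B ∈ insert C S, ∃ P, HasType Ax (.hyp 0 C :: Γ) P B := by
    rintro S Γ C h B (rfl | hB)
    · exact ⟨_, hasType_var_head _ _ _⟩
    · obtain ⟨P, hP⟩ := h B hB
      exact ⟨P, hP.weaken_hyp _ _⟩
  induction h with
  | ax h => exact fun Γ hΓ => hΓ _ h
  | topI => exact fun Γ _ => ⟨_, .star⟩
  | botE _ ih =>
    intro Γ hΓ
    obtain ⟨P, hP⟩ := ih Γ hΓ
    exact ⟨_, .abs hP⟩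
  | impE _ _ ih ih' =>
    intro Γ hΓ
    obtain ⟨P, hP⟩ := ih Γ hΓ
    obtain ⟨Q, hQ⟩ := ih' Γ hΓ
    exact ⟨_, .app hP hQ⟩
  | impI _ ih =>
    intro Γ hΓ
    obtain ⟨P, hP⟩ := ih _ (ins _ hΓ)
    exact ⟨_, .lam hP⟩
  | andE1 _ ih =>
    intro Γ hΓ
    obtain ⟨P, hP⟩ := ih Γ hΓ
    exact ⟨_, .fst hP⟩
  | andE2 _ ih =>
    intro Γ hΓ
    obtain ⟨P, hP⟩ := ih Γ hΓ
    exact ⟨_, .snd hP⟩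
  | andI _ _ ih ih' =>
    intro Γ hΓ
    obtain ⟨P, hP⟩ := ih Γ hΓ
    obtain ⟨Q, hQ⟩ := ih' Γ hΓ
    exact ⟨_, .pair hP hQ⟩
  | orI1 _ ih =>
    intro Γ hΓ
    obtain ⟨P, hP⟩ := ih Γ hΓ
    exact ⟨_, .inl hP⟩
  | orI2 _ ih =>
    intro Γ hΓ
    obtain ⟨P, hP⟩ := ih Γ hΓ
    exact ⟨_, .inr hP⟩
  | orE _ _ _ ih ihA ihB =>
    intro Γ hΓ
    obtain ⟨R, hR⟩ := ih Γ hΓ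
    obtain ⟨P, hP⟩ := ihA _ (ins _ hΓ)
    obtain ⟨Q, hQ⟩ := ihB _ (ins _ hΓ)
    exact ⟨_, .case hP hQ hR⟩
  | @modal S m B As _ _ ih ih' =>
    intro Γ hΓ
    obtain ⟨P, hP⟩ := ih' (.lock m :: Γ) fun A hA => by
      obtain ⟨Q, hQ⟩ := ih A hA Γ hΓ
      exact ⟨_, hQ.unlock hr⟩
    exact ⟨_, .lock hP⟩
  | @unfold S m l A _ hm ih =>
    intro Γ hΓ
    obtain ⟨P, hP⟩ := ih Γ hΓ
    exact HasType.exists_boxes l (.key hP hm (Context.locks_map_lock l))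

/-- Each discharged entry is restored: a hypothesis by applying to its variable, a lock by the key
for `m ⇛ m`. -/
theorem exists_hasType_of_close (hr : AxReflexive Ax) (Γ : Context 𝕄 𝕋) {A : Formula 𝕄 𝕋}
    (h : ∃ P, HasType Ax [] P (Γ.close A)) : ∃ P, HasType Ax Γ P A := by
  induction Γ generalizing A with
  | nil => exact h
  | cons e Γ ih =>
    cases e with
    | hyp x B =>
      obtain ⟨P, hP⟩ := ih h
      exact ⟨_, .app (hasType_var_head _ _ _) (hP.weaken_hyp x B)⟩
    | lock m =>
      obtain ⟨P, hP⟩ := ih h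
      exact ⟨_, hP.unlock hr⟩

theorem exists_hasType_iff (hr : AxReflexive Ax) {Γ : Context 𝕄 𝕋} {A : Formula 𝕄 𝕋} :
    (∃ P, HasType Ax Γ P A) ↔ Derivable Ax ∅ (Γ.close A) :=
  ⟨fun ⟨_, hP⟩ => derivable_of_hasType hP, fun h =>
    exists_hasType_of_close hr Γ (h.exists_hasType hr [] (by simp))⟩

theorem Context.primrec_close [Primcodable 𝕄] [Primcodable 𝕋] :
    Primrec₂ (Context.close : Context 𝕄 𝕋 → Formula 𝕄 𝕋 → Formula 𝕄 𝕋) := by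
  let step : Formula 𝕄 𝕋 → Entry 𝕄 𝕋 → Formula 𝕄 𝕋 := fun A e =>
    Sum.casesOn (Entry.equivSum 𝕄 𝕋 e) (fun p => .imp p.2 A) fun m => .box m A
  have hstep : Primrec₂ step := by
    refine Primrec.sumCasesOn ((Primrec.of_equiv (e := Entry.equivSum 𝕄 𝕋)).comp Primrec.snd) ?_ ?_
    · exact Formula.primrec_imp.comp (Primrec.snd.comp Primrec.snd)
        (Primrec.fst.comp Primrec.fst)
    · exact Formula.primrec_box.comp Primrec.snd (Primrec.fst.comp Primrec.fst)
  have h : Primrec fun s : Context 𝕄 𝕋 × Formula 𝕄 𝕋 => s.1.foldl step s.2 :=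
    Primrec.list_foldl Primrec.fst Primrec.snd
      (hstep.comp (Primrec.fst.comp Primrec.snd) (Primrec.snd.comp Primrec.snd)).to₂
  refine h.of_eq fun s => ?_
  obtain ⟨Γ, A⟩ := s
  dsimp only
  induction Γ generalizing A with
  | nil => rfl
  | cons e Γ ih => cases e <;> exact ih _

theorem computablePred_exists_hasType [Finite 𝕄] [Primcodable 𝕄] [Primcodable 𝕋]
    (hr : AxReflexive Ax) (ht : AxTransitive Ax) (hd : AxDecomposable Ax) :
    ComputablePred fun s : Context 𝕄 𝕋 × Formula 𝕄 𝕋 => ∃ P, HasType Ax s.1 P s.2 := by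
  obtain ⟨_, h⟩ := computablePred_derivable (𝕋 := 𝕋) hr ht hd
  have hf : Primrec fun s : Context 𝕄 𝕋 × Formula 𝕄 𝕋 =>
      (([], s.1.close s.2) : List (Formula 𝕄 𝕋) × Formula 𝕄 𝕋) :=
    Primrec.pair (Primrec.const _) Context.primrec_close
  refine (h.comp hf.to_comp).computablePred.of_eq fun s => ?_
  rw [exists_hasType_iff hr]
  simp

end

/-! ### Reflexive and transitive closure preserves derivability -/

section Closure

variable {𝕄 : Type u} {𝕋 : Type v} {Ax : Set (𝕄 × List 𝕄)}

theorem axReflexive_axClosure : AxReflexive (axClosure Ax) := fun m => InClosure.refl m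

theorem axTransitive_axClosure : AxTransitive (axClosure Ax) :=
  fun _ _ _ _ _ h h' => InClosure.trans h h'

/-- Substituting `r` for `n` in the middle of a list is an entailment applied beneath the prefix
`l`, with the suffix `l'` absorbed into the formula. Hence the induction quantifies over all `A`. -/
theorem InClosure.derivable {m : 𝕄} {l : List 𝕄} (h : InClosure Ax m l) :
    ∀ A : Formula 𝕄 𝕋, Derivable Ax {.box m A} (A.boxes l) := by
  induction h with
  | base h => exact fun A => .unfold (.ax rfl) h
  | refl m => exact fun A => .ax rfl
  | @trans m n l l' r _ _ ih ih' =>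
    intro A
    have h := ih A
    rw [Formula.boxes_append] at h
    rw [Formula.boxes_append, Formula.boxes_append]
    exact .boxes_mono (ih' (A.boxes l')) l h

theorem derivable_axClosure_iff {S : Set (Formula 𝕄 𝕋)} {A : Formula 𝕄 𝕋} :
    Derivable (axClosure Ax) S A ↔ Derivable Ax S A := by
  constructor
  · intro h
    induction h with
    | ax h => exact .ax h
    | topI => exact .topI
    | botE _ ih => exact .botE ih
    | impE _ _ ih ih' => exact .impE ih ih'
    | impI _ ih => exact .impI ih
    | andE1 _ ih => exact .andE1 ih
    | andE2 _ ih => exact .andE2 ih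
    | andI _ _ ih ih' => exact .andI ih ih'
    | orI1 _ ih => exact .orI1 ih
    | orI2 _ ih => exact .orI2 ih
    | orE _ _ _ ih ihA ihB => exact .orE ih ihA ihB
    | modal As _ _ ih ih' => exact .modal As ih ih'
    | @unfold S m l A _ hm ih =>
      exact .cut_list [.box m A] (by simpa using ih) ((InClosure.derivable hm A).mono (by simp))
  · intro h
    induction h with
    | ax h => exact .ax h
    | topI => exact .topI
    | botE _ ih => exact .botE ih
    | impE _ _ ih ih' => exact .impE ih ih'
    | impI _ ih => exact .impI ih
    | andE1 _ ih => exact .andE1 ih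
    | andE2 _ ih => exact .andE2 ih
    | andI _ _ ih ih' => exact .andI ih ih'
    | orI1 _ ih => exact .orI1 ih
    | orI2 _ ih => exact .orI2 ih
    | orE _ _ _ ih ihA ihB => exact .orE ih ihA ihB
    | modal As _ _ ih ih' => exact .modal As ih ih'
    | unfold _ hm ih => exact .unfold ih (InClosure.base hm)

theorem InClosure.comp {m n : 𝕄} {l : List 𝕄} (h : InClosure Ax m [n]) (h' : InClosure Ax n l) :
    InClosure Ax m l := axTransitive_axClosure.comp h h'

theorem InClosure.cons {m n n' r : 𝕄} {l : List 𝕄} (h : InClosure Ax m [n, r])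
    (hn : InClosure Ax n [n']) (hr : InClosure Ax r l) : InClosure Ax m (n' :: l) := by
  have h1 : InClosure Ax m ([n'] ++ r :: []) := InClosure.trans (l := []) h hn
  simpa using InClosure.trans h1 hr

end Closure

/-! ### Belief, interaction and public modalities -/

section Agents

variable {𝔸 : Type u} {le : 𝔸 → 𝔸 → Prop}

instance AgentModality.instFinite [Finite 𝔸] : Finite (AgentModality 𝔸) :=
  Finite.of_equiv _ (AgentModality.equivSum 𝔸).symm

/-- The modality is the belief of an agent above `a`. -/
def IsBeliefAbove (le : 𝔸 → 𝔸 → Prop) (a : 𝔸) (m : AgentModality 𝔸) : Prop :=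
  ∃ b, m = .belief b ∧ le a b

/-- The lists of modalities to which an interaction unfolds. -/
def InteractionUnfolds (le : 𝔸 → 𝔸 → Prop) (a c : 𝔸) : List (AgentModality 𝔸) → Prop
  | [] => False
  | .belief b :: l => le a b ∧ InteractionUnfolds le a c l
  | .interaction b d :: l => le a b ∧ le c d ∧ ∀ m ∈ l, IsBeliefAbove le c m
  | .pub :: _ => False

/-- An explicit description of the closure of the axioms for agents. -/
def AgentUnfolds (le : 𝔸 → 𝔸 → Prop) : AgentModality 𝔸 → List (AgentModality 𝔸) → Prop
  | .belief a, l => l ≠ [] ∧ ∀ m ∈ l, IsBeliefAbove le a m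
  | .interaction a c, l => InteractionUnfolds le a c l
  | .pub, _ => True

theorem interactionUnfolds_belief_append {a c : 𝔸} {r l : List (AgentModality 𝔸)}
    (hr : ∀ m ∈ r, IsBeliefAbove le a m) (hl : InteractionUnfolds le a c l) :
    InteractionUnfolds le a c (r ++ l) := by
  induction r with
  | nil => exact hl
  | cons m r ih =>
    obtain ⟨b, rfl, hb⟩ := hr m List.mem_cons_self
    exact ⟨hb, ih fun n hn => hr n (List.mem_cons_of_mem _ hn)⟩

theorem IsBeliefAbove.of_le (ht : ∀ a b c, le a b → le b c → le a c) {a b : 𝔸}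
    {m : AgentModality 𝔸} (hab : le a b) (h : IsBeliefAbove le b m) : IsBeliefAbove le a m := by
  obtain ⟨c, rfl, hc⟩ := h
  exact ⟨c, rfl, ht _ _ _ hab hc⟩

theorem AgentUnfolds.isBeliefAbove (ht : ∀ a b c, le a b → le b c → le a c) {a : 𝔸}
    {m : AgentModality 𝔸} {l : List (AgentModality 𝔸)} (hm : IsBeliefAbove le a m)
    (h : AgentUnfolds le m l) : l ≠ [] ∧ ∀ n ∈ l, IsBeliefAbove le a n := by
  obtain ⟨b, rfl, hb⟩ := hm
  exact ⟨h.1, fun n hn => (h.2 n hn).of_le ht hb⟩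

theorem interactionUnfolds_append (ht : ∀ a b c, le a b → le b c → le a c) {a b c d : 𝔸}
    {r l : List (AgentModality 𝔸)} (hab : le a b) (hcd : le c d)
    (hr : InteractionUnfolds le b d r) (hl : ∀ m ∈ l, IsBeliefAbove le c m) :
    InteractionUnfolds le a c (r ++ l) := by
  induction r with
  | nil => exact hr.elim
  | cons m r ih =>
    cases m with
    | belief e => exact ⟨ht _ _ _ hab hr.1, ih hr.2⟩
    | interaction e f =>
      refine ⟨ht _ _ _ hab hr.1, ht _ _ _ hcd hr.2.1, fun m hm => ?_⟩
      rcases List.mem_append.1 hm with hm | hm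
      · exact (hr.2.2 m hm).of_le ht hcd
      · exact hl m hm
    | pub => exact hr.elim

/-- An admissible list consists of beliefs above the receiver, one interaction, then beliefs above
the sender. Unfolding a belief stays in its segment, and unfolding the interaction extends the
segments on either side. -/
theorem InteractionUnfolds.trans (ht : ∀ a b c, le a b → le b c → le a c) {a c : 𝔸}
    {n : AgentModality 𝔸} {l l' r : List (AgentModality 𝔸)}
    (h : InteractionUnfolds le a c (l ++ n :: l')) (hn : AgentUnfolds le n r) :
    InteractionUnfolds le a c (l ++ r ++ l') := by
  induction l with
  | nil =>
    cases n with
    | belief b =>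
      exact interactionUnfolds_belief_append (hn.isBeliefAbove ht ⟨b, rfl, h.1⟩).2 h.2
    | interaction b d => exact interactionUnfolds_append ht h.1 h.2.1 hn h.2.2
    | pub => exact h.elim
  | cons m l ih =>
    cases m with
    | belief b => exact ⟨h.1, ih h.2⟩
    | interaction b d =>
      refine ⟨h.1, h.2.1, fun k hk => ?_⟩
      have h3 := hn.isBeliefAbove ht (h.2.2 n (by simp))
      simp only [List.append_eq, List.mem_append] at hk
      rcases hk with (hk | hk) | hk
      · exact h.2.2 k (by simp [hk])
      · exact h3.2 k hk
      · exact h.2.2 k (by simp [hk])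
    | pub => exact h.elim

theorem agentUnfolds_of_inClosure (hr : ∀ a, le a a) (ht : ∀ a b c, le a b → le b c → le a c)
    {m : AgentModality 𝔸} {l : List (AgentModality 𝔸)}
    (h : InClosure (agentAxioms le) m l) : AgentUnfolds le m l := by
  induction h with
  | base h =>
    cases (h : AgentAxiom le _ _) with
    | selfAwareness a => simp [AgentUnfolds, IsBeliefAbove, hr]
    | recipientAwareness a b => simp [AgentUnfolds, InteractionUnfolds, hr]
    | intentOfClaim a b => simp [AgentUnfolds, InteractionUnfolds, IsBeliefAbove, hr]
    | beliefInheritance h => simp [AgentUnfolds, IsBeliefAbove, h]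
    | receiverInheritance c h => simp [AgentUnfolds, InteractionUnfolds, hr, h]
    | senderInheritance c h => simp [AgentUnfolds, InteractionUnfolds, hr, h]
    | publicAwareness m => trivial
    | publicVerifiability => trivial
  | refl m =>
    cases m with
    | belief a => simp [AgentUnfolds, IsBeliefAbove, hr]
    | interaction a b => simp [AgentUnfolds, InteractionUnfolds, hr]
    | pub => trivial
  | @trans m n l l' r _ _ ih ih' =>
    cases m with
    | belief a =>
      have h3 := ih'.isBeliefAbove ht (ih.2 n (by simp))
      refine ⟨by simp [h3.1], fun k hk => ?_⟩
      simp only [List.mem_append] at hk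
      rcases hk with (hk | hk) | hk
      · exact ih.2 k (by simp [hk])
      · exact h3.2 k hk
      · exact ih.2 k (by simp [hk])
    | interaction a c => exact InteractionUnfolds.trans ht ih ih'
    | pub => trivial

theorem inClosure_pub (l : List (AgentModality 𝔸)) : InClosure (agentAxioms le) .pub l := by
  induction l with
  | nil => exact .base .publicVerifiability
  | cons n l ih => exact .cons (.base (.publicAwareness n)) (.refl n) ih

theorem inClosure_belief {a : 𝔸} {l : List (AgentModality 𝔸)} (hne : l ≠ [])
    (h : ∀ m ∈ l, IsBeliefAbove le a m) : InClosure (agentAxioms le) (.belief a) l := by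
  induction l with
  | nil => exact absurd rfl hne
  | cons m l ih =>
    obtain ⟨b, rfl, hb⟩ := h m List.mem_cons_self
    have h1 : InClosure (agentAxioms le) (.belief a) [.belief b] := .base (.beliefInheritance hb)
    rcases eq_or_ne l [] with rfl | hl
    · exact h1
    · exact .cons (.base (.selfAwareness a)) h1
        (ih hl fun m hm => h m (List.mem_cons_of_mem _ hm))

/-- Leading beliefs are generated by recipient awareness and trailing ones by intent of claim;
inheritance adjusts the agents. -/
theorem inClosure_interaction {a c : 𝔸} {l : List (AgentModality 𝔸)}
    (h : InteractionUnfolds le a c l) : InClosure (agentAxioms le) (.interaction a c) l := by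
  induction l with
  | nil => exact h.elim
  | cons m l ih =>
    cases m with
    | belief b =>
      exact .cons (.base (.recipientAwareness a c)) (.base (.beliefInheritance h.1)) (ih h.2)
    | interaction b d =>
      have h1 : InClosure (agentAxioms le) (.interaction a c) [.interaction b d] :=
        .comp (.base (.receiverInheritance c h.1)) (.base (.senderInheritance b h.2.1))
      rcases eq_or_ne l [] with rfl | hl
      · exact h1
      · exact .cons (.base (.intentOfClaim a c)) h1 (inClosure_belief hl h.2.2)
    | pub => exact h.elim

theorem inClosure_agentAxioms_iff (hr : ∀ a, le a a) (ht : ∀ a b c, le a b → le b c → le a c)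
    {m : AgentModality 𝔸} {l : List (AgentModality 𝔸)} :
    InClosure (agentAxioms le) m l ↔ AgentUnfolds le m l := by
  refine ⟨agentUnfolds_of_inClosure hr ht, fun h => ?_⟩
  cases m with
  | belief a => exact inClosure_belief h.1 h.2
  | interaction a c => exact inClosure_interaction h
  | pub => exact inClosure_pub l

/-- The remainder of a belief or of the public modality is itself. An interaction remains itself
after a belief, and becomes belief of the sender after its one interaction. -/
theorem axDecomposable_agentAxioms (hr : ∀ a, le a a) (ht : ∀ a b c, le a b → le b c → le a c) :
    AxDecomposable (axClosure (agentAxioms le)) := by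
  have iff : ∀ {m l}, (m, l) ∈ axClosure (agentAxioms le) ↔ AgentUnfolds le m l :=
    inClosure_agentAxioms_iff hr ht
  intro m n n' l h
  simp only [IsRemainder, iff] at h ⊢
  cases m with
  | belief a =>
    refine ⟨.belief a, ⟨by simp, ?_⟩, fun t r h' => ⟨by simp, fun k hk => ?_⟩⟩
    · exact List.forall_mem_pair.2 ⟨h.2 n (by simp), a, rfl, hr a⟩
    · exact h'.2 k (List.mem_cons_of_mem _ hk)
  | interaction a c =>
    cases n with
    | belief b =>
      exact ⟨.interaction a c, ⟨h.1, hr a, hr c, by simp⟩, fun t r h' => h'.2⟩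
    | interaction b d =>
      exact ⟨.belief c, ⟨h.1, h.2.1, List.forall_mem_singleton.2 ⟨c, rfl, hr c⟩⟩,
        fun t r h' => ⟨by simp, h'.2.2⟩⟩
    | pub => exact h.elim
  | pub => exact ⟨.pub, trivial, fun _ _ _ => trivial⟩

end Agents

end ModalLogic

theorem mainTheorem2 {𝕄 𝔸 𝕋 : Type*} [Finite 𝕄] [Primcodable 𝕄] [Finite 𝔸] [Primcodable 𝔸]
    [Primcodable 𝕋] :
    (∀ Ax : Set (𝕄 × List 𝕄), AxReflexive Ax → AxTransitive Ax → AxDecomposable Ax →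
      ComputablePred (fun s : List (Formula 𝕄 𝕋) × Formula 𝕄 𝕋 =>
        Derivable Ax {B | B ∈ s.1} s.2) ∧
      (∀ sub : 𝕄 → 𝕄 → Option 𝕄, IsSubtraction Ax sub →
        ComputablePred (fun s : List (Formula 𝕄 𝕋) × Formula 𝕄 𝕋 =>
          SeqProvable Ax sub s.1 s.2)) ∧
      ComputablePred (fun s : Context 𝕄 𝕋 × Formula 𝕄 𝕋 =>
        ∃ P : LTerm 𝕄 𝕋, HasType Ax s.1 P s.2)) ∧
    (∀ le : 𝔸 → 𝔸 → Prop, (∀ a, le a a) → (∀ a b c, le a b → le b c → le a c) →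
      AxReflexive (axClosure (agentAxioms le)) ∧
      AxTransitive (axClosure (agentAxioms le)) ∧
      AxDecomposable (axClosure (agentAxioms le)) ∧
      ComputablePred (fun s : List (Formula (AgentModality 𝔸) 𝕋) × Formula (AgentModality 𝔸) 𝕋 =>
        Derivable (agentAxioms le) {B | B ∈ s.1} s.2)) := by
  refine ⟨fun Ax hr ht hd => ⟨computablePred_derivable hr ht hd,
    fun sub hs => computablePred_seqProvable hr ht hs, computablePred_exists_hasType hr ht hd⟩,
    fun le hr ht => ⟨axReflexive_axClosure, axTransitive_axClosure,
      axDecomposable_agentAxioms hr ht, ?_⟩⟩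
  -- The given axioms need not be closed themselves, so decidability is transferred from their
  -- closure.
  exact (computablePred_derivable axReflexive_axClosure axTransitive_axClosure
    (axDecomposable_agentAxioms hr ht)).of_eq fun _ => derivable_axClosure_iff
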